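/- Let $k$ be an algebraically closed field of characteristic zero and let $\zeta_3\in k$ be a primitive cube root of unity. An embedding $\phi:G\hookrightarrow \mathsf{PGL}_3(k)$ of a finite group $G$, with the induced action of $G$ on $\mathbb P^2(k)$, is called \emph{intransitive} if $G$ fixes a point of $\mathbb P^2(k)$; \emph{imprimitive} if $G$ fixes no point of $\mathbb P^2(k)$ but has an orbit of length $3$; and \emph{primitive} if neither holds. If a finite group $G$ admits two embeddings $\phi,\psi: G\hookrightarrow\mathsf{PGL}_3(k)$ of different types, then $G\simeq C_3^2$, and one of $\phi,\psi$ is intransitive and the other is imprimitive. Moreover, up to conjugation in $\mathsf{PGL}_3(k)$ there are exactly two subgroups of $\mathsf{PGL}_3(k)$ isomorphic to $C_3^2$, namely $$\langle \mathrm{diag}(1,\zeta_3,1),\ \mathrm{diag}(1,1,\zeta_3)\rangle,$$ which is intransitive, and $$\langle \mathrm{diag}(1,\zeta_3,\zeta_3^2),\ (x_1,x_2,x_3)\mapsto(x_3,x_1,x_2)\rangle,$$ which is imprimitive; both are isomorphic to $C_3^2$, and they are not conjugate in $\mathsf{PGL}_3(k)$. -/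

import Mathlib

open scoped MatrixGroups LinearAlgebra.Projectivization

namespace PlaneAction

/-- The three types of actions of a group on the projective plane. -/
inductive ActionType
  | intransitive
  | imprimitive
  | primitive

variable {k : Type*} [Field k] {G : Type*} [Group G]

/-- The action of `G` on `ℙ²` given by `φ` fixes a point. -/
def FixesPoint (φ : G →* PGL(3, k)) : Prop :=
  ∃ p : ℙ k (Fin 3 → k), ∀ g : G, φ g • p = p

/-- The action of `G` on `ℙ²` given by `φ` has an orbit of length `3`. -/
def HasOrbitOfLengthThree (φ : G →* PGL(3, k)) : Prop :=
  ∃ p : ℙ k (Fin 3 → k), (Set.range fun g : G => φ g • p).ncard = 3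

/-- The action of `G` on `ℙ²` given by `φ` is of the type `t`: intransitive if `G` fixes a point,
imprimitive (that is, transitive but imprimitive) if it fixes no point but has an orbit of
length `3`, and primitive if it neither fixes a point nor has an orbit of length `3`. -/
def HasType (φ : G →* PGL(3, k)) : ActionType → Prop
  | .intransitive => FixesPoint φ
  | .imprimitive => ¬ FixesPoint φ ∧ HasOrbitOfLengthThree φ
  | .primitive => ¬ FixesPoint φ ∧ ¬ HasOrbitOfLengthThree φ

/-- Conjugacy of subgroups of a group. -/
def AreConjugate (H K : Subgroup G) : Prop :=
  ∃ g : G, H.map (MulAut.conj g).toMonoidHom = K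

/-- The class in `PGL₃` of the diagonal matrix with the entries `a, b, c`. -/
def diag (a b c : kˣ) : PGL(3, k) :=
  Matrix.ProjGenLinGroup.mk
    { val := Matrix.diagonal ![(a : k), b, c]
      inv := Matrix.diagonal ![((a⁻¹ : kˣ) : k), ((b⁻¹ : kˣ) : k), ((c⁻¹ : kˣ) : k)]
      val_inv := by
        rw [Matrix.diagonal_mul_diagonal, ← Matrix.diagonal_one]
        congr 1; funext i; fin_cases i <;> simp
      inv_val := by
        rw [Matrix.diagonal_mul_diagonal, ← Matrix.diagonal_one]
        congr 1; funext i; fin_cases i <;> simp }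

/-- The cyclic permutation `(x₁, x₂, x₃) ↦ (x₃, x₁, x₂)` as an element of `GL₃`. -/
def cyclicGL (k : Type*) [Field k] : GL (Fin 3) k where
  val := !![0, 0, 1; 1, 0, 0; 0, 1, 0]
  inv := !![0, 1, 0; 0, 0, 1; 1, 0, 0]
  val_inv := by ext i j; fin_cases i <;> fin_cases j <;> simp [Matrix.mul_apply, Fin.sum_univ_three]
  inv_val := by ext i j; fin_cases i <;> fin_cases j <;> simp [Matrix.mul_apply, Fin.sum_univ_three]

theorem cyclicGL_mulVec (x : Fin 3 → k) :
    (cyclicGL k : Matrix (Fin 3) (Fin 3) k).mulVec x = ![x 2, x 0, x 1] := by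
  funext i
  fin_cases i <;> simp [cyclicGL, Matrix.mulVec, dotProduct, Fin.sum_univ_three]

/-- The class in `PGL₃` of the cyclic permutation of the coordinates. -/
def cyclic (k : Type*) [Field k] : PGL(3, k) := Matrix.ProjGenLinGroup.mk (cyclicGL k)

/-- The subgroup `⟨diag(1, ζ, 1), diag(1, 1, ζ)⟩` of `PGL₃`. -/
def diagonalSubgroup (ζ : kˣ) : Subgroup PGL(3, k) :=
  Subgroup.closure {diag 1 ζ 1, diag 1 1 ζ}

/-- The subgroup `⟨diag(1, ζ, ζ²), (x₁, x₂, x₃) ↦ (x₃, x₁, x₂)⟩` of `PGL₃`. -/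
def heisenbergSubgroup (ζ : kˣ) : Subgroup PGL(3, k) :=
  Subgroup.closure {diag 1 ζ (ζ ^ 2), cyclic k}

/-- The group `C₃²`. -/
abbrev C3Squared : Type := Multiplicative (ZMod 3) × Multiplicative (ZMod 3)

end PlaneAction

/-! Lift an action to matrices `M g` in GL₃, multiplicative up to scalars; a fixed point is then a
common eigenvector. Elements that commute in `G` have lifts commuting up to a scalar `ω`, and
determinants give `ω ^ 3 = 1`. If `ω ≠ 1`, both elements have order 3, and in a suitable basis they
are diag(1, ω, ω²) and the cyclic permutation.

The engine is `IsLift.exists_noncommuting`. Let `G` fix no point and let `h ≠ 1` be centralized or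
inverted by every element. A Clifford argument (`IsLift.exists_permutesLines`) makes `G` permute
three eigenlines of `h` transitively, so there is an orbit of length 3. The centralizer of `h` has
index at most 2, so it cannot fix all three lines: some `t` commutes with `h` while their lifts do
not commute.

Suppose one action has a fixed point and the other has none. By Maschke the first embeds `G` in GL₂,
and finite subgroups of GL₂ contain such an `h` (`exists_centralized_or_inverted`). The resulting
pair `h`, `t` generates a C₃² in GL₂, which contains a nontrivial scalar `z`, central in `G`. The
engine applied to `z` gives `s` whose lift does not commute with that of `z`. The elements whose
lifts commute with the lift of `z` form an abelian normal subgroup which together with `s` generates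
`G`; inside GL₂ this makes `G` abelian. By Schur's lemma `z` and `s` then generate `G`, so `G` is
C₃².

Suppose neither action has a fixed point and `φ` has an orbit of length 3. The orbit gives a basis
of lines permuted by `G`. Either the elements diagonal under `φ` have commuting lifts under `ψ` and
are not all trivial, and Clifford applies to `ψ`, or there is an element centralized or inverted by
all of `G` (a 3-cycle, or one acting as diag(1, ω, ω²)), and the engine applies. So `ψ` also has
such an orbit.

For the classification, the lifts of a C₃² either commute, and are simultaneously diagonal, or they
do not, and the normal form for `ω ≠ 1` applies. Only the first kind fixes a point. -/

namespace PlaneAction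

open Matrix Module

/-! ### Matrices modulo scalars and common eigenbases -/

section Basics

variable {n : Type*} [Fintype n] [DecidableEq n] {k : Type*} [Field k]

theorem gl_smul_def (A : GL n k) (v : n → k) : A • v = (A : Matrix n n k) *ᵥ v := rfl

theorem scalar_smul (u : kˣ) (v : n → k) : GeneralLinearGroup.scalar n u • v = (u : k) • v := by
  rw [gl_smul_def]
  simp

theorem gl_ext_basis {ι : Type*} (b : Basis ι k (n → k)) {A B : GL n k}
    (h : ∀ i, A • b i = B • b i) : A = B := by
  apply Units.ext
  apply Matrix.toLin'.injective
  apply b.ext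
  intro i
  simpa using! h i

theorem mk_eq_mk_iff_smul {A B : GL n k} :
    (ProjGenLinGroup.mk A = ProjGenLinGroup.mk B) ↔
      ∃ c : k, c ≠ 0 ∧ ∀ v : n → k, A • v = c • B • v := by
  rw [eq_comm, ProjGenLinGroup.mk_eq_mk_iff]
  constructor
  · rintro ⟨u, rfl⟩
    refine ⟨u, u.ne_zero, fun v ↦ ?_⟩
    rw [mul_smul, scalar_smul, smul_comm]
  · rintro ⟨c, hc, h⟩
    refine ⟨Units.mk0 c hc, gl_ext_basis (Pi.basisFun k n) fun i ↦ ?_⟩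
    rw [mul_smul, scalar_smul, h, smul_comm]
    rfl

theorem mk_eq_mk_of_basis {ι : Type*} (b : Basis ι k (n → k)) {A B : GL n k} {c : k} (hc : c ≠ 0)
    (h : ∀ i, A • b i = c • B • b i) : ProjGenLinGroup.mk A = ProjGenLinGroup.mk B := by
  rw [eq_comm, ProjGenLinGroup.mk_eq_mk_iff]
  refine ⟨Units.mk0 c hc, gl_ext_basis b fun i ↦ ?_⟩
  rw [mul_smul, scalar_smul, h, smul_comm]
  rfl

theorem mk_eq_one_of_basis {ι : Type*} (b : Basis ι k (n → k)) {A : GL n k} {c : k} (hc : c ≠ 0)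
    (h : ∀ i, A • b i = c • b i) : ProjGenLinGroup.mk A = 1 := by
  rw [← map_one ProjGenLinGroup.mk]
  exact mk_eq_mk_of_basis b hc (by simpa using h)

theorem eigenvalue_ne_zero {A : GL n k} {v : n → k} (hv : v ≠ 0) {c : k} (h : A • v = c • v) :
    c ≠ 0 := by
  rintro rfl
  rw [zero_smul, smul_eq_zero_iff_eq] at h
  exact hv h

theorem pow_smul_eigenvector {A : GL n k} {v : n → k} {c : k} (h : A • v = c • v) (m : ℕ) :
    (A ^ m) • v = c ^ m • v := by
  induction m with
  | zero => simp
  | succ m ih => rw [pow_succ, mul_smul, h, smul_comm, ih, smul_smul, pow_succ, mul_comm]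

theorem inv_smul_eigenvector {A : GL n k} {v : n → k} (hv : v ≠ 0) {c : k} (h : A • v = c • v) :
    A⁻¹ • v = c⁻¹ • v := by
  rw [inv_smul_eq_iff, smul_comm, h, smul_smul, inv_mul_cancel₀ (eigenvalue_ne_zero hv h), one_smul]

/-- A commuting family of matrices of finite order modulo scalars has a common eigenbasis. -/
theorem exists_common_eigenbasis [IsAlgClosed k] [CharZero k] {ι : Type*} (A : ι → GL n k)
    (hcomm : ∀ i j, A i * A j = A j * A i) (hfin : ∀ i, IsOfFinOrder (ProjGenLinGroup.mk (A i))) :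
    ∃ (b : Basis n k (n → k)) (χ : ι → n → k), ∀ i j, A i • b j = χ i j • b j := by
  let T : ι → End k (n → k) := fun i ↦ Matrix.toLin' (A i : Matrix n n k)
  have hT : ∀ i v, T i v = A i • v := fun i v ↦ rfl
  have hTc : Pairwise (Function.onFun Commute T) := by
    intro i j _
    ext1 v
    apply LinearMap.ext
    intro w
    simp only [Module.End.mul_apply, hT, LinearMap.comp_apply, ← mul_smul, hcomm i j]
  have hss : ∀ i, (T i).IsFinitelySemisimple := by
    intro i
    obtain ⟨m, hm, h1⟩ := isOfFinOrder_iff_pow_eq_one.1 (hfin i)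
    rw [← map_pow, ← map_one ProjGenLinGroup.mk, mk_eq_mk_iff_smul] at h1
    obtain ⟨c, hc, h1⟩ := h1
    -- A power of `A i` is a nonzero scalar `c`, so `A i` is a root of `X ^ m - c`, which is
    -- separable in characteristic zero.
    refine (Module.End.isSemisimple_of_squarefree_aeval_eq_zero
      (p := Polynomial.X ^ m - Polynomial.C c) ?_ ?_).isFinitelySemisimple
    · exact (Polynomial.separable_X_pow_sub_C c (Nat.cast_ne_zero.2 hm.ne') hc).squarefree
    · apply LinearMap.ext
      intro v
      have hp : ∀ j : ℕ, ∀ v, (T i ^ j) v = (A i ^ j) • v := by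
        intro j
        induction j with
        | zero => simp
        | succ j ih =>
          intro v
          rw [pow_succ, pow_succ, Module.End.mul_apply, hT, ih, mul_smul]
      simp [hp, h1]
  have htop := Module.End.iSup_iInf_maxGenEigenspace_eq_top_of_iSup_maxGenEigenspace_eq_top_of_commute
    T hTc (fun i ↦ Module.End.iSup_maxGenEigenspace_eq_top (T i))
  let C : Set (n → k) := {v | ∀ i, ∃ c : k, A i • v = c • v}
  have hC : ⊤ ≤ Submodule.span k C := by
    rw [← htop]
    refine iSup_le fun χ v hv ↦ Submodule.subset_span fun i ↦ ⟨χ i, ?_⟩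
    have := (Submodule.mem_iInf _).1 hv i
    rw [(hss i).maxGenEigenspace_eq_eigenspace, Module.End.mem_eigenspace_iff] at this
    exact this
  let b := (Basis.ofSpan hC)
  have hb : ∀ j, b j ∈ C := fun j ↦ Basis.ofSpan_subset hC ⟨j, rfl⟩
  let e := b.indexEquiv (Pi.basisFun k n)
  have : ∀ i j, ∃ c : k, A i • (b.reindex e) j = c • (b.reindex e) j := by
    intro i j
    rw [Basis.reindex_apply]
    exact hb _ i
  choose χ hχ using this
  exact ⟨b.reindex e, χ, hχ⟩

/-- If `w` is an eigenvector of an operator that is diagonal in the basis `b`, then every basis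
vector which occurs in `w` has the same eigenvalue. -/
theorem eigenvalue_eq_of_repr_ne_zero {ι : Type*} [Finite ι] (b : Basis ι k (n → k)) {A : GL n k}
    {χ : ι → k} (hA : ∀ i, A • b i = χ i • b i) {w : n → k} {θ : k} (hw : A • w = θ • w) {i : ι}
    (hi : b.repr w i ≠ 0) : θ = χ i := by
  have := Fintype.ofFinite ι
  classical
  have h1 : A • w = ∑ j, (χ j * b.repr w j) • b j := by
    conv_lhs => rw [← b.sum_repr w]
    rw [Finset.smul_sum]
    refine Finset.sum_congr rfl fun j _ ↦ ?_
    rw [smul_comm, hA, smul_smul, mul_comm]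
  have h2 : b.repr (A • w) i = χ i * b.repr w i := by
    rw [h1, b.repr_sum_self]
  rw [hw] at h2
  simp only [map_smul, Finsupp.smul_apply, smul_eq_mul] at h2
  exact mul_right_cancel₀ hi h2

end Basics

/-! ### Supports of vectors in a basis -/

section BasisExpansion

variable {n : Type*} {k : Type*} [Field k]

theorem eq_smul_of_repr {ι : Type*} [Finite ι] (b : Basis ι k (n → k)) {w : n → k} {i : ι}
    (h : ∀ j, b.repr w j ≠ 0 → j = i) : w = b.repr w i • b i := by
  have := Fintype.ofFinite ι
  classical
  conv_lhs => rw [← b.sum_repr w]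
  refine Finset.sum_eq_single i (fun j _ hj ↦ ?_) (by simp)
  by_contra hne
  exact hj (h j fun h0 ↦ hne (by rw [h0, zero_smul]))

theorem exists_repr_ne_zero {ι : Type*} (b : Basis ι k (n → k)) {w : n → k} (hw : w ≠ 0) :
    ∃ i, b.repr w i ≠ 0 := by
  by_contra! h
  exact hw (b.repr.map_eq_zero_iff.1 (Finsupp.ext h))

end BasisExpansion

/-! ### Projective lifts and the Clifford argument -/

section Lifts

variable {k : Type*} [Field k] {G : Type*} [Group G]

/-- `M` chooses representatives in `GL₃` of the values of `φ`. -/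
def IsLift (M : G → GL (Fin 3) k) (φ : G →* PGL(3, k)) : Prop :=
  ∀ g, ProjGenLinGroup.mk (M g) = φ g

theorem exists_isLift (φ : G →* PGL(3, k)) : ∃ M : G → GL (Fin 3) k, IsLift M φ :=
  ⟨fun g ↦ (ProjGenLinGroup.mk_surjective (φ g)).choose,
    fun g ↦ (ProjGenLinGroup.mk_surjective (φ g)).choose_spec⟩

variable {M : G → GL (Fin 3) k} {φ : G →* PGL(3, k)}

theorem IsLift.mul (hM : IsLift M φ) (g h : G) :
    ∃ c : k, c ≠ 0 ∧ ∀ v : Fin 3 → k, M (g * h) • v = c • M g • M h • v := by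
  have : ProjGenLinGroup.mk (M (g * h)) = ProjGenLinGroup.mk (M g * M h) := by
    rw [map_mul, hM, hM, hM, map_mul]
  simpa only [mul_smul] using mk_eq_mk_iff_smul.1 this

theorem IsLift.one (hM : IsLift M φ) :
    ∃ c : k, c ≠ 0 ∧ ∀ v : Fin 3 → k, M 1 • v = c • v := by
  have : ProjGenLinGroup.mk (M 1) = ProjGenLinGroup.mk 1 := by
    rw [hM, map_one, map_one]
  simpa only [one_smul] using mk_eq_mk_iff_smul.1 this

theorem IsLift.inv (hM : IsLift M φ) (g : G) :
    ∃ c : k, c ≠ 0 ∧ ∀ v : Fin 3 → k, M g⁻¹ • v = c • (M g)⁻¹ • v := by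
  have : ProjGenLinGroup.mk (M g⁻¹) = ProjGenLinGroup.mk (M g)⁻¹ := by
    rw [map_inv, hM, hM, map_inv]
  exact mk_eq_mk_iff_smul.1 this

theorem IsLift.conj (hM : IsLift M φ) (a g : G) :
    ∃ c : k, c ≠ 0 ∧ ∀ v : Fin 3 → k, M a • M g • v = c • M g • M (g⁻¹ * a * g) • v := by
  have : ProjGenLinGroup.mk (M a * M g) = ProjGenLinGroup.mk (M g * M (g⁻¹ * a * g)) := by
    rw [map_mul, map_mul, hM, hM, hM, ← map_mul, ← map_mul]
    congr 1
    group
  simpa only [mul_smul] using mk_eq_mk_iff_smul.1 this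

theorem IsLift.swap (hM : IsLift M φ) {a g : G} (h : a * g = g * a) :
    ∃ c : k, c ≠ 0 ∧ ∀ v : Fin 3 → k, M a • M g • v = c • M g • M a • v := by
  obtain ⟨c, hc, hv⟩ := hM.conj a g
  rw [mul_assoc, h, inv_mul_cancel_left] at hv
  exact ⟨c, hc, hv⟩

theorem IsLift.comm_of_lift_comm (hM : IsLift M φ) (hφ : Function.Injective φ) {g h : G}
    (hgh : M g * M h = M h * M g) : g * h = h * g := by
  apply hφ
  rw [map_mul, map_mul, ← hM, ← hM, ← map_mul, hgh, map_mul]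

theorem IsLift.eq_one (hM : IsLift M φ) (hφ : Function.Injective φ)
    {ι : Type*} (b : Basis ι k (Fin 3 → k)) {g : G} {c : k} (hc : c ≠ 0)
    (h : ∀ i, M g • b i = c • b i) : g = 1 := by
  apply hφ
  rw [map_one, ← hM]
  exact mk_eq_one_of_basis b hc h

theorem IsLift.isOfFinOrder [Finite G] (hM : IsLift M φ) (g : G) :
    IsOfFinOrder (ProjGenLinGroup.mk (M g)) := by
  rw [hM]
  exact φ.isOfFinOrder (isOfFinOrder_of_finite g)

theorem IsLift.smul_mk (hM : IsLift M φ) (g : G) {v : Fin 3 → k} (hv : v ≠ 0) :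
    φ g • Projectivization.mk k v hv =
      Projectivization.mk k (M g • v) ((smul_ne_zero_iff_ne (M g)).2 hv) := by
  rw [← hM]
  rfl

theorem IsLift.smul_mk_eq_iff (hM : IsLift M φ) (g : G) {v w : Fin 3 → k} (hv : v ≠ 0)
    (hw : w ≠ 0) : φ g • Projectivization.mk k v hv = Projectivization.mk k w hw ↔
      ∃ c : k, M g • v = c • w := by
  rw [hM.smul_mk, Projectivization.mk_eq_mk_iff']
  simp only [eq_comm]

theorem IsLift.fixesPoint_iff (hM : IsLift M φ) :
    FixesPoint φ ↔ ∃ v : Fin 3 → k, v ≠ 0 ∧ ∀ g, ∃ c : k, M g • v = c • v := by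
  constructor
  · rintro ⟨p, hp⟩
    induction p using Projectivization.ind with | _ v hv =>
    exact ⟨v, hv, fun g ↦ (hM.smul_mk_eq_iff g hv hv).1 (hp g)⟩
  · rintro ⟨v, hv, h⟩
    exact ⟨Projectivization.mk k v hv, fun g ↦ (hM.smul_mk_eq_iff g hv hv).2 (h g)⟩

theorem eq_of_smul_basis_eq {b : Basis (Fin 3) k (Fin 3 → k)} {i j : Fin 3} {x y : k}
    {w : Fin 3 → k} (hw : w ≠ 0) (hi : w = x • b i) (hj : w = y • b j) : i = j := by
  by_contra hne
  apply hw
  have h2 := congrArg (fun w ↦ b.repr w i) (hi.symm.trans hj)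
  simp [Ne.symm hne] at h2
  rw [hi, h2, zero_smul]

/-- The lines spanned by the vectors of a basis are permuted transitively. -/
def PermutesLines (M : G → GL (Fin 3) k) (b : Basis (Fin 3) k (Fin 3 → k)) : Prop :=
  (∀ g i, ∃ j, ∃ c : k, M g • b i = c • b j) ∧ ∀ i j, ∃ g, ∃ c : k, M g • b i = c • b j

theorem IsLift.hasOrbitOfLengthThree (hM : IsLift M φ) {b : Basis (Fin 3) k (Fin 3 → k)}
    (hb : PermutesLines M b) : HasOrbitOfLengthThree φ := by
  let p : Fin 3 → ℙ k (Fin 3 → k) := fun i ↦ Projectivization.mk k (b i) (b.ne_zero i)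
  have hp : Function.Injective p := by
    intro i j hij
    obtain ⟨c, hc⟩ := (Projectivization.mk_eq_mk_iff' k _ _ _ _).1 hij
    by_contra hne
    have := congrArg (fun w ↦ b.repr w i) hc
    simp [Ne.symm hne] at this
  refine ⟨p 0, ?_⟩
  have : (Set.range fun g : G ↦ φ g • p 0) = Set.range p := by
    ext q
    constructor
    · rintro ⟨g, rfl⟩
      obtain ⟨j, hj⟩ := hb.1 g 0
      exact ⟨j, ((hM.smul_mk_eq_iff g (b.ne_zero 0) (b.ne_zero j)).2 hj).symm⟩
    · rintro ⟨j, rfl⟩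
      obtain ⟨g, hg⟩ := hb.2 0 j
      exact ⟨g, (hM.smul_mk_eq_iff g (b.ne_zero 0) (b.ne_zero j)).2 hg⟩
  rw [this, ← Set.image_univ, Set.ncard_image_of_injective _ hp, Set.ncard_univ]
  simp

/-- Three points cannot fall into several orbits unless one of the orbits is a single point. -/
theorem transitive_of_no_fixed {Γ α : Type*} [Group Γ] [MulAction Γ α] (φ : G →* Γ) (p : Fin 3 → α)
    (h : ∀ g i, ∃ j, φ g • p i = p j) (hfix : ∀ i, ∃ g, φ g • p i ≠ p i) (i j : Fin 3) :
    ∃ g, φ g • p i = p j := by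
  have key : ∀ i j l : Fin 3, (∀ m, m = i ∨ m = j ∨ m = l) → (∃ g, φ g • p i = p j) →
      ∃ g, φ g • p i = p l := by
    intro i j l hm hij
    obtain ⟨g, hg⟩ := hij
    obtain ⟨s, hs⟩ := hfix l
    obtain ⟨m, hsm⟩ := h s l
    rcases hm m with rfl | rfl | rfl
    · exact ⟨s⁻¹, by rw [← hsm, map_inv, inv_smul_smul]⟩
    · exact ⟨s⁻¹ * g, by rw [map_mul, mul_smul, hg, ← hsm, map_inv, inv_smul_smul]⟩
    · exact absurd hsm hs
  by_cases hij : i = j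
  · exact ⟨1, by rw [hij, map_one, one_smul]⟩
  obtain ⟨s, hs⟩ := hfix i
  obtain ⟨m, hsm⟩ := h s i
  by_cases hmj : m = j
  · exact ⟨s, hmj ▸ hsm⟩
  have hmi : m ≠ i := by
    rintro rfl
    exact hs hsm
  have cover : ∀ i j m : Fin 3, ¬ i = j → ¬ m = j → m ≠ i → ∀ r, r = i ∨ r = m ∨ r = j := by decide
  exact key i m j (cover i j m hij hmj hmi) ⟨s, hsm⟩

theorem IsLift.permutesLines (hM : IsLift M φ) (hφ : ¬ FixesPoint φ)
    {b : Basis (Fin 3) k (Fin 3 → k)} (hb : ∀ g i, ∃ j, ∃ c : k, M g • b i = c • b j) :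
    PermutesLines M b := by
  refine ⟨hb, fun i j ↦ ?_⟩
  let p : Fin 3 → ℙ k (Fin 3 → k) := fun i ↦ Projectivization.mk k (b i) (b.ne_zero i)
  have hp : ∀ g i j, φ g • p i = p j ↔ ∃ c : k, M g • b i = c • b j :=
    fun g i j ↦ hM.smul_mk_eq_iff g (b.ne_zero i) (b.ne_zero j)
  obtain ⟨g, hg⟩ := transitive_of_no_fixed φ p (fun g i ↦ by simpa only [hp] using hb g i)
    (fun i ↦ by
      by_contra! h
      exact hφ ⟨p i, h⟩) i j
  exact ⟨g, (hp g i j).1 hg⟩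

/-- A finite group that fixes no point and has a conjugation-invariant nontrivial subset with
commuting lifts permutes the three lines of a common eigenbasis transitively. -/
theorem IsLift.exists_permutesLines [IsAlgClosed k] [CharZero k] [Finite G] (hM : IsLift M φ)
    (hφ : ¬ FixesPoint φ) (S : Set G) (hS : ∀ g, ∀ a ∈ S, g⁻¹ * a * g ∈ S)
    (hcomm : ∀ a ∈ S, ∀ c ∈ S, M a * M c = M c * M a) (hne : ∃ a ∈ S, φ a ≠ 1) :
    ∃ (b : Basis (Fin 3) k (Fin 3 → k)) (χ : G → Fin 3 → k),
      (∀ a ∈ S, ∀ i, M a • b i = χ a i • b i) ∧ (∀ i j, i ≠ j → ∃ a ∈ S, χ a i ≠ χ a j) ∧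
      PermutesLines M b := by
  classical
  obtain ⟨b, χ', hχ'⟩ := exists_common_eigenbasis (fun a : S ↦ M a)
    (fun a c ↦ hcomm a a.2 c c.2) (fun a ↦ hM.isOfFinOrder a)
  obtain ⟨χ, hχ⟩ : ∃ χ : G → Fin 3 → k, ∀ a ∈ S, ∀ i, M a • b i = χ a i • b i :=
    ⟨fun a ↦ if h : a ∈ S then χ' ⟨a, h⟩ else 0, fun a ha i ↦ by
      simpa [ha] using hχ' ⟨a, ha⟩ i⟩
  -- The scalar depends on `a` and `g` but not on `i`, so conjugation by `g` permutes the
  -- eigencharacters up to one common twist.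
  have hconj : ∀ a g, ∃ c : k, c ≠ 0 ∧ (a ∈ S → ∀ i, M a • M g • b i =
      (c * χ (g⁻¹ * a * g) i) • M g • b i) := by
    intro a g
    obtain ⟨c, hc, h⟩ := hM.conj a g
    refine ⟨c, hc, fun ha i ↦ ?_⟩
    rw [h, hχ _ (hS g a ha), smul_comm (M g), smul_smul]
  choose c hc0 hc using hconj
  have hsupp : ∀ g i j, b.repr (M g • b i) j ≠ 0 → ∀ a ∈ S,
      c a g * χ (g⁻¹ * a * g) i = χ a j :=
    fun g i j hj a ha ↦ eigenvalue_eq_of_repr_ne_zero b (hχ a ha) (hc a g ha i) hj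
  have hne0 : ∀ g i, ∃ j, b.repr (M g • b i) j ≠ 0 :=
    fun g i ↦ exists_repr_ne_zero b ((smul_ne_zero_iff_ne (M g)).2 (b.ne_zero i))
  -- If the characters at `i` and `j` agreed, the third, at `l`, would differ, as `S` is not scalar.
  -- If `M g` moved the line of `b l`, it would send both `b i` and `b j` into that line, against
  -- injectivity; so that line would be a fixed point.
  have hdist : ∀ i j, i ≠ j → ∃ a ∈ S, χ a i ≠ χ a j := by
    intro i j hij
    by_contra! heq
    obtain ⟨l, hli, hlj, hl⟩ : ∃ l, l ≠ i ∧ l ≠ j ∧ ∀ m, m = i ∨ m = j ∨ m = l := by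
      have cover : ∀ i j : Fin 3, i ≠ j → ∃ l, l ≠ i ∧ l ≠ j ∧ ∀ m, m = i ∨ m = j ∨ m = l := by
        decide
      exact cover i j hij
    obtain ⟨a, ha, hal⟩ : ∃ a ∈ S, χ a l ≠ χ a i := by
      by_contra! hall
      obtain ⟨a, ha, hφa⟩ := hne
      refine hφa ?_
      rw [← hM]
      refine mk_eq_one_of_basis b (c := χ a i) (eigenvalue_ne_zero (b.ne_zero i) (hχ a ha i))
        fun m ↦ ?_
      rw [hχ a ha]
      rcases hl m with rfl | rfl | rfl
      · rfl
      · rw [heq a ha]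
      · rw [hall a ha]
    refine hφ (hM.fixesPoint_iff.2 ⟨b l, b.ne_zero l, fun g ↦ ?_⟩)
    obtain ⟨m, hm⟩ := hne0 g l
    by_cases hml : ∀ j, b.repr (M g • b l) j ≠ 0 → j = l
    · exact ⟨_, eq_smul_of_repr b hml⟩
    exfalso
    push Not at hml
    obtain ⟨m, hm, hml⟩ := hml
    have hθ : ∀ a ∈ S, c a g * χ (g⁻¹ * a * g) l = χ a i := by
      intro a ha
      rw [hsupp g l m hm a ha]
      rcases hl m with rfl | rfl | rfl
      · rfl
      · rw [heq a ha]
      · exact absurd rfl hml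
    have ha' : g * a * g⁻¹ ∈ S := by
      simpa using hS g⁻¹ a ha
    have hgg : g⁻¹ * (g * a * g⁻¹) * g = a := by group
    have hother : ∀ s, χ a s = χ a i → ∀ r, b.repr (M g • b s) r ≠ 0 → r = l := by
      intro s hs r hr
      have h1 := hsupp g s r hr _ ha'
      have h2 := hθ _ ha'
      rw [hgg] at h1 h2
      have h3 : χ (g * a * g⁻¹) r = χ (g * a * g⁻¹) i → False := by
        intro h3
        rw [h3, ← h2] at h1
        rw [hs] at h1
        exact hal (mul_left_cancel₀ (hc0 _ _) h1).symm
      rcases hl r with rfl | rfl | rfl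
      · exact (h3 rfl).elim
      · exact (h3 (heq _ ha').symm).elim
      · rfl
    have h1 := eq_smul_of_repr b (hother i rfl)
    have h2 := eq_smul_of_repr b (hother j (heq a ha).symm)
    obtain ⟨r, hr⟩ := hne0 g i
    have hrl := hother i rfl r hr
    rw [hrl] at hr
    set x := b.repr (M g • b i) l
    set y := b.repr (M g • b j) l
    have h3 : M g • (y • b i - x • b j) = 0 := by
      rw [smul_sub, smul_comm, smul_comm _ x, h1, h2, smul_smul, smul_smul, mul_comm, sub_self]
    rw [smul_eq_zero_iff_eq] at h3
    have := congrArg (fun w ↦ b.repr w j) h3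
    simp [hij] at this
    exact hr this
  refine ⟨b, χ, hχ, hdist, hM.permutesLines hφ fun g i ↦ ?_⟩
  obtain ⟨j, hj⟩ := hne0 g i
  refine ⟨j, _, eq_smul_of_repr b fun m hm ↦ ?_⟩
  by_contra hmj
  obtain ⟨a, ha, hne⟩ := hdist m j hmj
  exact hne ((hsupp g i m hm a ha).symm.trans (hsupp g i j hj a ha))

/-- A nontrivial element which every element centralizes or inverts. -/
theorem IsLift.exists_noncommuting [IsAlgClosed k] [CharZero k] [Finite G] (hM : IsLift M φ)
    (hinj : Function.Injective φ) (hφ : ¬ FixesPoint φ) {h : G} (h1 : h ≠ 1)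
    (hh : ∀ g, g * h * g⁻¹ = h ∨ g * h * g⁻¹ = h⁻¹) :
    HasOrbitOfLengthThree φ ∧ ∃ t, t * h = h * t ∧ M t * M h ≠ M h * M t := by
  obtain ⟨d, hd0, hd⟩ := hM.inv h
  have hinv : M h * M h⁻¹ = M h⁻¹ * M h := by
    refine gl_ext_basis (Pi.basisFun k (Fin 3)) fun i ↦ ?_
    rw [mul_smul, mul_smul, hd, hd, smul_comm, smul_inv_smul, inv_smul_smul]
  obtain ⟨b, χ, hχ, hdist, hperm⟩ := hM.exists_permutesLines hφ {h, h⁻¹} (by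
      intro g a ha
      have h2 := hh g⁻¹
      rw [inv_inv] at h2
      have h3 : g⁻¹ * h⁻¹ * g = (g⁻¹ * h * g)⁻¹ := by group
      rcases ha with rfl | rfl
      · exact h2
      · rw [h3]
        rcases h2 with h2 | h2 <;> rw [h2]
        · exact Or.inr rfl
        · rw [inv_inv]; exact Or.inl rfl)
    (by
      rintro a (rfl | rfl) c (rfl | rfl)
      · rfl
      · exact hinv
      · exact hinv.symm
      · rfl)
    ⟨h, Or.inl rfl, fun h2 ↦ h1 (hinj (by rw [h2, map_one]))⟩
  refine ⟨hM.hasOrbitOfLengthThree hperm, ?_⟩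
  have hχh := hχ h (Or.inl rfl)
  -- The eigenvalues of the lift of `h⁻¹` are proportional to the inverses of those of `M h`, so `h`
  -- alone separates the lines.
  have hdist' : ∀ i j, χ h i = χ h j → i = j := by
    intro i j hij
    by_contra hne
    obtain ⟨a, ha, hne'⟩ := hdist i j hne
    have hχi : ∀ i, χ h⁻¹ i = d * (χ h i)⁻¹ := by
      intro i
      have h2 := hχ h⁻¹ (Or.inr rfl) i
      rw [hd, inv_smul_eigenvector (b.ne_zero i) (hχh i), smul_smul] at h2
      exact (smul_left_injective k (b.ne_zero i) h2).symm
    rcases ha with rfl | rfl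
    · exact hne' hij
    · rw [hχi, hχi, hij] at hne'
      exact hne' rfl
  by_contra! hcon
  have hfix : ∀ t, t * h = h * t → ∀ i, ∃ c : k, M t • b i = c • b i := by
    intro t ht i
    have h2 := hcon t ht
    have h3 : M h • M t • b i = χ h i • M t • b i := by
      rw [← mul_smul, ← h2, mul_smul, hχh, smul_comm]
    exact ⟨_, eq_smul_of_repr b fun j hj ↦
      (hdist' _ _ (eigenvalue_eq_of_repr_ne_zero b hχh h3 hj)).symm⟩
  have hnz : ∀ g i, M g • b i ≠ 0 := fun g i ↦ (smul_ne_zero_iff_ne (M g)).2 (b.ne_zero i)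
  obtain ⟨g, x, hg⟩ := hperm.2 0 1
  obtain ⟨g', x', hg'⟩ := hperm.2 0 2
  have hcomm : ∀ g, g * h * g⁻¹ = h → g * h = h * g := fun g hg ↦
    mul_inv_eq_iff_eq_mul.1 hg
  have hi : g * h * g⁻¹ = h⁻¹ := (hh g).resolve_left fun h2 ↦ by
    obtain ⟨y, hy⟩ := hfix g (hcomm g h2) 0
    exact absurd (eq_of_smul_basis_eq (hnz g 0) hg hy) (by decide)
  have hi' : g' * h * g'⁻¹ = h⁻¹ := (hh g').resolve_left fun h2 ↦ by
    obtain ⟨y, hy⟩ := hfix g' (hcomm g' h2) 0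
    exact absurd (eq_of_smul_basis_eq (hnz g' 0) hg' hy) (by decide)
  have hi'' : (g⁻¹ * g') * h = h * (g⁻¹ * g') := by
    rw [mul_inv_eq_iff_eq_mul] at hi hi'
    rw [mul_assoc, hi', ← mul_assoc, ← mul_assoc]
    congr 1
    rw [inv_mul_eq_iff_eq_mul, ← mul_assoc, hi]
    group
  obtain ⟨y, hy⟩ := hfix _ hi'' 0
  obtain ⟨e, he, hge⟩ := hM.mul g (g⁻¹ * g')
  rw [mul_inv_cancel_left] at hge
  have := hge (b 0)
  rw [hy, smul_comm (M g), hg, smul_smul, smul_smul] at this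
  exact absurd (eq_of_smul_basis_eq (hnz g' 0) hg' this) (by decide)

end Lifts

/-! ### Matrices commuting up to a cube root of unity -/

section Heisenberg

variable {k : Type*} [Field k]

/-- If `ω ^ 3 = 1`, then `ω ^ (i + j)` makes sense for `i j : Fin 3`. -/
theorem pow_fin_add {ω : k} (h : ω ^ 3 = 1) (i j : Fin 3) :
    ω ^ ((i + j : Fin 3) : ℕ) = ω ^ (i : ℕ) * ω ^ (j : ℕ) := by
  rw [← pow_add, Fin.val_add]
  exact (pow_eq_pow_mod _ h).symm

theorem exists_pow_eq_of_cube_eq_one {a c : k} (ha : a ^ 3 = 1) (hc : c ^ 3 = 1) (ha1 : a ≠ 1) :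
    ∃ j < 3, c = a ^ j := by
  have hp : IsPrimitiveRoot a 3 := by
    have := orderOf_eq_prime ha ha1
    exact this ▸ IsPrimitiveRoot.orderOf a
  obtain ⟨j, hj, h⟩ := hp.eq_pow_of_pow_eq_one hc
  exact ⟨j, hj, h.symm⟩

theorem pow_fin_injective {ω : k} (h : ω ^ 3 = 1) (h1 : ω ≠ 1) {i j : Fin 3}
    (hij : ω ^ (i : ℕ) = ω ^ (j : ℕ)) : i = j := by
  have hp : IsPrimitiveRoot ω 3 := by
    have := orderOf_eq_prime h h1
    exact this ▸ IsPrimitiveRoot.orderOf ω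
  exact Fin.ext (hp.pow_inj i.2 j.2 hij)

/-- The scalar by which two matrices commute is a cube root of unity. -/
theorem cube_eq_one_of_comm {B C : GL (Fin 3) k} {ω : k}
    (h : ∀ v : Fin 3 → k, B • C • v = ω • C • B • v) : ω ^ 3 = 1 := by
  have h1 : (B : Matrix (Fin 3) (Fin 3) k) * C = ω • ((C : Matrix (Fin 3) (Fin 3) k) * B) := by
    apply Matrix.toLin'.injective
    apply LinearMap.ext
    intro v
    have := h v
    simp only [gl_smul_def] at this
    simpa [smul_mulVec] using this
  have h2 := congrArg Matrix.det h1
  rw [det_smul, det_mul, det_mul, mul_comm (det (C : Matrix (Fin 3) (Fin 3) k)),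
    Fintype.card_fin] at h2
  have hB : det (B : Matrix (Fin 3) (Fin 3) k) ≠ 0 := (B.isUnit.map detMonoidHom).ne_zero
  have hC : det (C : Matrix (Fin 3) (Fin 3) k) ≠ 0 := (C.isUnit.map detMonoidHom).ne_zero
  exact (mul_right_cancel₀ (mul_ne_zero hB hC) (h2.symm.trans (one_mul _).symm))

/-- Normal form of two matrices that commute up to a nontrivial scalar. -/
theorem exists_heisenberg_basis [IsAlgClosed k] {B C : GL (Fin 3) k} {ω : k} (hω : ω ≠ 1)
    (h : ∀ v : Fin 3 → k, B • C • v = ω • C • B • v) :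
    ∃ (b : Basis (Fin 3) k (Fin 3 → k)) (β γ : k), β ≠ 0 ∧ γ ≠ 0 ∧
      (∀ i : Fin 3, B • b i = (β * ω ^ (i : ℕ)) • b i) ∧ ∀ i, C • b i = γ • b (i + 1) := by
  have hω3 := cube_eq_one_of_comm h
  obtain ⟨β, hβ⟩ := Module.End.exists_eigenvalue (Matrix.toLin' (B : Matrix (Fin 3) (Fin 3) k))
  obtain ⟨v, hv⟩ := hβ.exists_hasEigenvector
  have hv0 : v ≠ 0 := hv.2
  have hBv : B • v = β • v := hv.apply_eq_smul
  have hβ0 := eigenvalue_ne_zero hv0 hBv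
  have hCv : ∀ m : ℕ, B • (C ^ m) • v = (β * ω ^ m) • (C ^ m) • v := by
    intro m
    induction m with
    | zero => simp [hBv]
    | succ m ih =>
      rw [pow_succ', mul_smul, h, ih, smul_comm C, smul_smul, pow_succ]
      congr 1
      ring
  have hCv0 : ∀ m : ℕ, (C ^ m) • v ≠ 0 := fun m ↦ (smul_ne_zero_iff_ne _).2 hv0
  have hli : LinearIndependent k (fun i : Fin 3 ↦ (C ^ (i : ℕ)) • v) := by
    refine Module.End.eigenvectors_linearIndependent'
      (Matrix.toLin' (B : Matrix (Fin 3) (Fin 3) k)) (fun i : Fin 3 ↦ β * ω ^ (i : ℕ)) ?_ _ ?_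
    · intro i j hij
      exact pow_fin_injective hω3 hω (mul_left_cancel₀ hβ0 hij)
    · intro i
      rw [Module.End.hasEigenvector_iff, Module.End.mem_eigenspace_iff]
      exact ⟨hCv i, hCv0 i⟩
  let b := basisOfLinearIndependentOfCardEqFinrank hli (by simp)
  have hb : ∀ i : Fin 3, b i = (C ^ (i : ℕ)) • v := fun i ↦ by simp [b]
  have hBb : ∀ i : Fin 3, B • b i = (β * ω ^ (i : ℕ)) • b i := fun i ↦ by
    rw [hb, hCv]
  -- `C ^ 3` returns `v` to its own one-dimensional eigenspace. Rescaling `C ^ i • v` by `γ⁻¹ ^ i`,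
  -- with `γ` a cube root of the factor `x`, makes the action of `C` uniform around the cycle.
  have h3 : (C ^ 3) • v = b.repr ((C ^ 3) • v) 0 • b 0 := by
    refine eq_smul_of_repr b fun j hj ↦ ?_
    have h4 := eigenvalue_eq_of_repr_ne_zero b hBb (hCv 3) hj
    refine (pow_fin_injective hω3 hω ?_).symm
    have h5 := mul_left_cancel₀ hβ0 h4
    rw [hω3] at h5
    simpa using h5
  set x := b.repr ((C ^ 3) • v) 0
  have hb0 : b 0 = v := by simp [hb]
  rw [hb0] at h3
  have hx0 : x ≠ 0 := by
    intro hx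
    rw [hx, zero_smul] at h3
    exact hCv0 3 h3
  obtain ⟨γ, hγ⟩ := IsAlgClosed.exists_pow_nat_eq x (n := 3) (by norm_num)
  have hγ0 : γ ≠ 0 := by
    rintro rfl
    exact hx0 (by rw [← hγ]; simp)
  let u : Fin 3 → kˣ := fun i ↦ (Units.mk0 γ hγ0)⁻¹ ^ (i : ℕ)
  have hu : ∀ i, (b.unitsSMul u) i = (γ⁻¹ ^ (i : ℕ)) • b i := fun i ↦ by
    rw [Basis.unitsSMul_apply, Units.smul_def]
    simp [u]
  refine ⟨b.unitsSMul u, β, γ, hβ0, hγ0, fun i ↦ ?_, fun i ↦ ?_⟩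
  · rw [hu, smul_comm B, hBb, smul_comm]
  · rw [hu, hu, smul_comm C, hb, hb, ← mul_smul, ← pow_succ', smul_smul]
    fin_cases i
    · simp [hγ0]
    · simp [pow_succ, hγ0]
    · simp only [Fin.reduceFinMk, Fin.isValue]
      simp [h3, smul_smul, ← hγ]
      congr 1
      field_simp

end Heisenberg

/-! ### The commutator pairing of lifts -/

section Pairs

variable {k : Type*} [Field k] {G : Type*} [Group G] {M : G → GL (Fin 3) k} {φ : G →* PGL(3, k)}

theorem comm_ne_one {B C : GL (Fin 3) k} (hBC : B * C ≠ C * B) {ω : k}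
    (h : ∀ v : Fin 3 → k, B • C • v = ω • C • B • v) : ω ≠ 1 := by
  rintro rfl
  refine hBC (gl_ext_basis (Pi.basisFun k (Fin 3)) fun i ↦ ?_)
  rw [mul_smul, mul_smul, h, one_smul]

/-- Commuting elements with noncommuting lifts have order `3`. -/
theorem IsLift.cube_eq_one [IsAlgClosed k] (hM : IsLift M φ) (hinj : Function.Injective φ)
    {a c : G} (hac : a * c = c * a) (hne : M a * M c ≠ M c * M a) : a ^ 3 = 1 := by
  obtain ⟨ω, -, h⟩ := hM.swap hac
  obtain ⟨b, β, -, hβ, -, hB, -⟩ := exists_heisenberg_basis (comm_ne_one hne h) h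
  have h3 := cube_eq_one_of_comm h
  apply hinj
  rw [map_pow, map_one, ← hM, ← map_pow]
  refine mk_eq_one_of_basis b (pow_ne_zero 3 hβ) fun i ↦ ?_
  rw [pow_smul_eigenvector (hB i), mul_pow, ← pow_mul, mul_comm (i : ℕ), pow_mul, h3, one_pow,
    mul_one]

/-- A lift of `a ^ j` is a scalar multiple of `M a ^ j`, which commutes with `M a`. This supplies
the independence needed in `closure_pair_equiv`. -/
theorem IsLift.ne_pow (hM : IsLift M φ) {a c : G}
    (hne : M a * M c ≠ M c * M a) (j : ℕ) : c ≠ a ^ j := by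
  rintro rfl
  apply hne
  have : ProjGenLinGroup.mk (M (a ^ j)) = ProjGenLinGroup.mk (M a ^ j) := by
    rw [hM, map_pow, map_pow, hM]
  obtain ⟨c, hc, h⟩ := mk_eq_mk_iff_smul.1 this
  refine gl_ext_basis (Pi.basisFun k (Fin 3)) fun i ↦ ?_
  rw [mul_smul, mul_smul, h, h, smul_comm (M a), ← mul_smul, ← mul_smul, (Commute.self_pow _ _).eq]

/-- Scalars pass through every lift, so for fixed `x` the commutator scalar is multiplicative in the
other argument. -/
theorem IsLift.swap_mul (hM : IsLift M φ) {x y z : G} (p q : k)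
    (hy : ∀ v : Fin 3 → k, M x • M y • v = p • M y • M x • v)
    (hz : ∀ v : Fin 3 → k, M x • M z • v = q • M z • M x • v) (v : Fin 3 → k) :
    M x • M (y * z) • v = (p * q) • M (y * z) • M x • v := by
  obtain ⟨c, hc, hcv⟩ := hM.mul y z
  rw [hcv, smul_comm (M x) c, hy, hz, smul_comm (M y) q, hcv, smul_smul p q, smul_comm c]

/-- A commutative group that has two elements with noncommuting lifts is generated by them. -/
theorem IsLift.closure_eq_top [IsAlgClosed k] (hM : IsLift M φ) (hinj : Function.Injective φ)
    (hG : ∀ a c : G, a * c = c * a) {z t : G} (hne : M z * M t ≠ M t * M z) :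
    Subgroup.closure {z, t} = ⊤ := by
  obtain ⟨ω, hω0, h⟩ := hM.swap (hG z t)
  have hω := comm_ne_one hne h
  have hω3 := cube_eq_one_of_comm h
  obtain ⟨b, β, γ, hβ, hγ, hB, hC⟩ := exists_heisenberg_basis hω h
  have hadj : ∀ (x : G) (y : G), ∃ i : ℕ, ∀ v : Fin 3 → k, M x • M y • v = ω ^ i • M y • M x • v := by
    intro x y
    obtain ⟨c, -, hc⟩ := hM.swap (hG x y)
    obtain ⟨i, -, rfl⟩ := exists_pow_eq_of_cube_eq_one hω3 (cube_eq_one_of_comm hc) hω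
    exact ⟨i, hc⟩
  have hswap : ∀ g : G, ∃ i : ℕ, ∃ j : ℕ, (∀ v : Fin 3 → k, M z • M (g * z ^ i * t ^ j) • v =
      M (g * z ^ i * t ^ j) • M z • v) ∧ (∀ v : Fin 3 → k, M t • M (g * z ^ i * t ^ j) • v =
      M (g * z ^ i * t ^ j) • M t • v) := by
    have h' : ∀ v : Fin 3 → k, M t • M z • v = ω ^ 2 • M z • M t • v := by
      intro v
      rw [h, smul_smul (ω ^ 2) ω, ← pow_succ, hω3, one_smul]
    have hpow : ∀ (g : G) (p q : k), (∀ v : Fin 3 → k, M z • M g • v = p • M g • M z • v) →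
        (∀ v : Fin 3 → k, M t • M g • v = q • M g • M t • v) → ∀ i j : ℕ,
        (∀ v : Fin 3 → k, M z • M (g * z ^ i * t ^ j) • v =
          (p * ω ^ j) • M (g * z ^ i * t ^ j) • M z • v) ∧
        (∀ v : Fin 3 → k, M t • M (g * z ^ i * t ^ j) • v =
          (q * (ω ^ 2) ^ i) • M (g * z ^ i * t ^ j) • M t • v) := by
      intro g p q hp hq i j
      induction j with
      | zero =>
        induction i with
        | zero => simpa using ⟨hp, hq⟩
        | succ i ih =>
          simp only [pow_zero, mul_one] at ih ⊢
          rw [pow_succ, ← mul_assoc, pow_succ (ω ^ 2), ← mul_assoc q]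
          have := hM.swap_mul (z := z) p 1 ih.1 (by simp)
          rw [mul_one] at this
          exact ⟨this, hM.swap_mul _ _ ih.2 h'⟩
      | succ j ih =>
        rw [pow_succ, ← mul_assoc, pow_succ ω, ← mul_assoc p]
        have := hM.swap_mul (z := t) _ 1 ih.2 (by simp)
        rw [mul_one] at this
        exact ⟨hM.swap_mul _ _ ih.1 h, this⟩
    intro g
    obtain ⟨p, hp⟩ := hadj z g
    obtain ⟨q, hq⟩ := hadj t g
    -- The pairing of `z` with `t` is `ω` and that of `t` with `z` is `ω ^ 2`, so these exponents
    -- turn the scalars `ω ^ p`, `ω ^ q` of `g` into `ω ^ (3 * p)` and `ω ^ (3 * q)`.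
    refine ⟨q, 2 * p, ?_⟩
    obtain ⟨h1, h2⟩ := hpow g _ _ hp hq q (2 * p)
    have e1 : ω ^ p * ω ^ (2 * p) = 1 := by
      rw [← pow_add, show p + 2 * p = 3 * p by ring, pow_mul, hω3, one_pow]
    have e2 : ω ^ q * (ω ^ 2) ^ q = 1 := by
      rw [← pow_mul, ← pow_add, show q + 2 * q = 3 * q by ring, pow_mul, hω3, one_pow]
    rw [e1] at h1
    rw [e2] at h2
    simpa using And.intro h1 h2
  rw [eq_top_iff]
  intro g _
  obtain ⟨i, j, h1, h2⟩ := hswap g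
  set x := g * z ^ i * t ^ j with hx
  -- Schur's lemma by hand: commuting with `M z` makes `M x` diagonal, and commuting with the cyclic
  -- `M t` makes its entries equal.
  have hdiag : ∀ m : Fin 3, ∃ c : k, M x • b m = c • b m := by
    intro m
    have h3 := h1 (b m)
    rw [hB, smul_comm (M x)] at h3
    exact ⟨_, eq_smul_of_repr b fun l hl ↦ (pow_fin_injective hω3 hω (mul_left_cancel₀ hβ
      (eigenvalue_eq_of_repr_ne_zero b hB h3 hl))).symm⟩
  choose d hd using hdiag
  have hd1 : ∀ m, d m = d (m + 1) := by
    intro m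
    have h3 := h2 (b m)
    rw [hC, hd, smul_comm (M t), hC, smul_comm (M x), hd, smul_smul, smul_smul, mul_comm] at h3
    exact mul_left_cancel₀ hγ (smul_left_injective k (b.ne_zero _) h3)
  have hx1 : x = 1 := by
    refine hM.eq_one hinj b (eigenvalue_ne_zero (b.ne_zero 0) (hd 0)) fun m ↦ ?_
    rw [hd]
    congr 1
    fin_cases m
    · rfl
    · exact (hd1 0).symm
    · exact (hd1 1).symm.trans (hd1 0).symm
  have hg : g = (z ^ i * t ^ j)⁻¹ := by
    rw [eq_inv_iff_mul_eq_one, ← mul_assoc]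
    exact hx1
  rw [hg]
  have hz : z ∈ Subgroup.closure {z, t} := Subgroup.subset_closure (by simp)
  have ht : t ∈ Subgroup.closure {z, t} := Subgroup.subset_closure (by simp)
  exact inv_mem (mul_mem (pow_mem hz i) (pow_mem ht j))

end Pairs

/-! ### Recognizing C₃² -/

section ThreeTorsion

/-- Since `y` is no power of `x` and both have order 3, the cyclic groups they generate meet
trivially, so the map from C₃² is injective. -/
theorem closure_pair_equiv {Γ : Type*} [Group Γ] {x y : Γ} (hxy : x * y = y * x) (hx : x ^ 3 = 1)
    (hy : y ^ 3 = 1) (hx1 : x ≠ 1) (hne : ∀ j : ℕ, y ≠ x ^ j) :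
    Nonempty (Subgroup.closure {x, y} ≃* C3Squared) := by
  have hord : ∀ u : Γ, u ^ 3 = 1 → ∃ f : Multiplicative (ZMod 3) →* Γ,
      (∀ j : ℕ, f (Multiplicative.ofAdd (j : ZMod 3)) = u ^ j) := by
    intro u hu
    have h0 : (zmultiplesHom (Additive Γ)) (Additive.ofMul u) ((3 : ℕ) : ℤ) = 0 := by
      change ((3 : ℕ) : ℤ) • Additive.ofMul u = 0
      rw [natCast_zsmul, ← ofMul_pow, hu, ofMul_one]
    refine ⟨AddMonoidHom.toMultiplicativeLeft (ZMod.lift 3 ⟨_, h0⟩), fun j ↦ ?_⟩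
    change Additive.toMul (ZMod.lift 3 ⟨_, h0⟩ (j : ZMod 3)) = u ^ j
    rw [← Int.cast_natCast (R := ZMod 3) j, ZMod.lift_coe]
    simp
  obtain ⟨f, hf⟩ := hord x hx
  obtain ⟨g, hg⟩ := hord y hy
  have hsurj : ∀ m : Multiplicative (ZMod 3), ∃ j : ℕ, j < 3 ∧
      m = Multiplicative.ofAdd (j : ZMod 3) := fun m ↦
    ⟨(Multiplicative.toAdd m).val, ZMod.val_lt _, by
      rw [ZMod.natCast_zmod_val]; rfl⟩
  have hcomm : ∀ m n, Commute (f m) (g n) := by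
    intro m n
    obtain ⟨i, -, rfl⟩ := hsurj m
    obtain ⟨j, -, rfl⟩ := hsurj n
    rw [hf, hg]
    exact (Commute.pow_pow (show Commute x y from hxy) i j)
  let F := MonoidHom.noncommCoprod f g hcomm
  have hF : ∀ i j : ℕ, F (Multiplicative.ofAdd (i : ZMod 3), Multiplicative.ofAdd (j : ZMod 3)) =
      x ^ i * y ^ j := fun i j ↦ by
    rw [MonoidHom.noncommCoprod_apply, hf, hg]
  have hFinj : Function.Injective F := by
    rw [injective_iff_map_eq_one]
    rintro ⟨m, n⟩ hmn
    obtain ⟨i, hi, rfl⟩ := hsurj m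
    obtain ⟨j, hj, rfl⟩ := hsurj n
    rw [hF] at hmn
    have hj0 : j = 0 := by
      have h2 : y ^ j = x ^ (2 * i) := by
        rw [← mul_right_inj (x ^ i), hmn, ← pow_add, show i + 2 * i = 3 * i by ring, pow_mul, hx,
          one_pow]
      interval_cases j
      · rfl
      · exact (hne _ (by rw [← h2, pow_one])).elim
      · refine (hne (2 * (2 * i)) ?_).elim
        rw [mul_comm 2 (2 * i), pow_mul, ← h2, ← pow_mul, show 2 * 2 = 3 + 1 by rfl, pow_succ, hy,
          one_mul]
    subst hj0
    have hi0 : i = 0 := by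
      rw [pow_zero, mul_one] at hmn
      interval_cases i
      · rfl
      · exact (hx1 (by simpa using hmn)).elim
      · refine (hx1 ?_).elim
        rw [pow_succ, hmn, one_mul] at hx
        exact hx
    subst hi0
    simp
  have hrange : F.range = Subgroup.closure {x, y} := by
    apply le_antisymm
    · rintro _ ⟨⟨m, n⟩, rfl⟩
      obtain ⟨i, -, rfl⟩ := hsurj m
      obtain ⟨j, -, rfl⟩ := hsurj n
      rw [hF]
      exact mul_mem (pow_mem (Subgroup.subset_closure (by simp)) i)
        (pow_mem (Subgroup.subset_closure (by simp)) j)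
    · rw [Subgroup.closure_le]
      rintro u (rfl | rfl)
      · exact ⟨_, (hF 1 0).trans (by simp)⟩
      · exact ⟨_, (hF 0 1).trans (by simp)⟩
  exact ⟨((MonoidHom.ofInjective hFinj).trans (MulEquiv.subgroupCongr hrange)).symm⟩

end ThreeTorsion

/-! ### Maschke's theorem and the passage to GL₂ -/

section Complement

variable {k : Type*} [Field k] {G : Type*} [Group G] {M : G → GL (Fin 3) k} {φ : G →* PGL(3, k)}

/-- Maschke's theorem for projective representations. -/
theorem IsLift.exists_invariant_compl [CharZero k] [Finite G] (hM : IsLift M φ)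
    (W : Submodule k (Fin 3 → k)) (hW : ∀ g, ∀ w ∈ W, M g • w ∈ W) :
    ∃ W' : Submodule k (Fin 3 → k), IsCompl W W' ∧ ∀ g, ∀ w ∈ W', M g • w ∈ W' := by
  have := Fintype.ofFinite G
  have hN : (Fintype.card G : k) ≠ 0 := Nat.cast_ne_zero.2 Fintype.card_ne_zero
  obtain ⟨π, hπ⟩ := W.subtype.exists_leftInverse_of_injective W.ker_subtype
  have hπ' : ∀ w (hw : w ∈ W), (π w : Fin 3 → k) = w := fun w hw ↦
    congrArg Subtype.val (LinearMap.congr_fun hπ ⟨w, hw⟩)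
  -- The lift occurs once directly and once inverted, so its arbitrary scalar cancels and the
  -- average is still equivariant.
  let P : (Fin 3 → k) → (Fin 3 → k) := fun v ↦ ∑ g, M g • (π ((M g)⁻¹ • v) : Fin 3 → k)
  have hPW : ∀ v, P v ∈ W := fun v ↦ Submodule.sum_mem _ fun g _ ↦ hW g _ (π _).2
  let F : (Fin 3 → k) →ₗ[k] W :=
    { toFun := fun v ↦ (Fintype.card G : k)⁻¹ • ⟨P v, hPW v⟩
      map_add' := fun v w ↦ by
        rw [← smul_add]
        congr 1
        ext1
        simp [P, Finset.sum_add_distrib]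
      map_smul' := fun c v ↦ by
        rw [RingHom.id_apply, smul_comm c]
        congr 1
        ext1
        simp [P, Finset.smul_sum, smul_comm _ c] }
  have hF : ∀ v, (F v : Fin 3 → k) = (Fintype.card G : k)⁻¹ • P v := fun v ↦ rfl
  have hWinv : ∀ g, ∀ w ∈ W, (M g)⁻¹ • w ∈ W := by
    intro g w hw
    obtain ⟨c, hc, h⟩ := hM.inv g
    have := hW g⁻¹ w hw
    rw [h] at this
    exact (W.smul_mem_iff hc).1 this
  refine ⟨LinearMap.ker F, LinearMap.isCompl_of_proj fun w ↦ ?_, fun g w hw ↦ ?_⟩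
  · ext1
    rw [hF]
    have : P w = (Fintype.card G : k) • (w : Fin 3 → k) := by
      simp only [P]
      rw [Finset.sum_congr rfl fun g _ ↦ by
        rw [hπ' _ (hWinv g w w.2), smul_inv_smul], Finset.sum_const, Finset.card_univ,
        Nat.cast_smul_eq_nsmul]
    rw [this, smul_smul, inv_mul_cancel₀ hN, one_smul]
  · rw [LinearMap.mem_ker, ← Submodule.coe_eq_zero, hF, smul_eq_zero_iff_right (inv_ne_zero hN)]
      at hw ⊢
    have : P (M g • w) = M g • P w := by
      simp only [P]
      rw [← Equiv.sum_comp (Equiv.mulLeft g), Finset.smul_sum]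
      refine Finset.sum_congr rfl fun h _ ↦ ?_
      obtain ⟨c, hc, hgh⟩ := hM.mul g h
      rw [Equiv.coe_mulLeft, hgh]
      have h2 : (M (g * h))⁻¹ • M g • w = c⁻¹ • (M h)⁻¹ • w := by
        rw [inv_smul_eq_iff, hgh, smul_comm (M h), smul_inv_smul, smul_comm (M g), smul_smul,
          mul_inv_cancel₀ hc, one_smul]
      rw [h2, map_smul, Submodule.coe_smul, smul_comm (M h), smul_comm (M g), smul_smul,
        mul_inv_cancel₀ hc, one_smul]
    rw [this, hw, smul_zero]

/-- A finite group acting on the plane with a fixed point embeds in `GL₂`. -/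
theorem exists_embedding_GL_two [CharZero k] [Finite G] (hinj : Function.Injective φ)
    (hφ : FixesPoint φ) : ∃ σ : G →* GL (Fin 2) k, Function.Injective σ := by
  obtain ⟨M, hM⟩ := exists_isLift φ
  obtain ⟨v, hv, hfix⟩ := hM.fixesPoint_iff.1 hφ
  choose c hc using hfix
  have hc0 : ∀ g, c g ≠ 0 := fun g ↦ eigenvalue_ne_zero hv (hc g)
  obtain ⟨W, hW, hWM⟩ := hM.exists_invariant_compl (Submodule.span k {v}) (by
    intro g w hw
    obtain ⟨a, rfl⟩ := Submodule.mem_span_singleton.1 hw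
    rw [smul_comm, hc]
    exact Submodule.smul_mem _ _ (Submodule.smul_mem _ _ (Submodule.mem_span_singleton_self v)))
  have hrank : finrank k W = 2 := by
    have := Submodule.finrank_add_eq_of_isCompl hW
    rw [finrank_span_singleton hv, Module.finrank_fin_fun] at this
    omega
  -- Dividing `M g` by its eigenvalue on the fixed vector `v` removes the scalar ambiguity and
  -- leaves a genuine representation on `W`.
  let ρ : G →* (W →ₗ[k] W) :=
    { toFun := fun g ↦
        { toFun := fun w ↦ ⟨(c g)⁻¹ • M g • (w : Fin 3 → k), W.smul_mem _ (hWM g w w.2)⟩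
          map_add' := fun x y ↦ by ext1; simp
          map_smul' := fun a x ↦ by ext1; simp [smul_comm _ a] }
      map_one' := by
        obtain ⟨d, hd, h⟩ := hM.one
        have h1 : c 1 = d := smul_left_injective k hv ((hc 1).symm.trans (h v))
        ext1 w
        ext1
        change (c 1)⁻¹ • M 1 • (w : Fin 3 → k) = w
        rw [h, h1, smul_smul, inv_mul_cancel₀ hd, one_smul]
      map_mul' := fun g h ↦ by
        obtain ⟨d, hd, hgh⟩ := hM.mul g h
        have h1 : c (g * h) = d * (c h * c g) := by
          refine smul_left_injective k hv ((hc (g * h)).symm.trans ?_)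
          rw [hgh, hc h, smul_comm (M g), hc g, smul_smul, smul_smul, mul_assoc]
        ext1 w
        ext1
        change (c (g * h))⁻¹ • M (g * h) • (w : Fin 3 → k) =
          (c g)⁻¹ • M g • (c h)⁻¹ • M h • (w : Fin 3 → k)
        rw [hgh, h1, smul_comm (M g) (c h)⁻¹, smul_smul _ d, smul_smul (c g)⁻¹ (c h)⁻¹]
        congr 1
        have := hc0 g
        have := hc0 h
        field_simp }
  have hρ : ∀ g (w : W), ((ρ g w : W) : Fin 3 → k) = (c g)⁻¹ • M g • (w : Fin 3 → k) :=
    fun g w ↦ rfl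
  have hρinj : Function.Injective ρ := by
    rw [injective_iff_map_eq_one]
    intro g hg
    refine hM.eq_one hinj (Pi.basisFun k (Fin 3)) (hc0 g) fun i ↦ ?_
    generalize Pi.basisFun k (Fin 3) i = x
    obtain ⟨y, hy, w, hw, rfl⟩ := Submodule.mem_sup.1
      (show x ∈ Submodule.span k {v} ⊔ W by rw [hW.sup_eq_top]; trivial)
    obtain ⟨a, rfl⟩ := Submodule.mem_span_singleton.1 hy
    have h1 := hρ g ⟨w, hw⟩
    rw [hg, Module.End.one_apply, eq_inv_smul_iff₀ (hc0 g)] at h1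
    rw [smul_add, smul_comm, hc, ← h1, smul_add, smul_comm a]
  let e : Basis (Fin 2) k W := finBasisOfFinrankEq k W hrank
  let σ : G →* Matrix (Fin 2) (Fin 2) k :=
    ((LinearMap.toMatrixAlgEquiv e : (W →ₗ[k] W) →* Matrix (Fin 2) (Fin 2) k)).comp ρ
  refine ⟨σ.toHomUnits, fun g h hgh ↦ hρinj ?_⟩
  have := congrArg Units.val hgh
  rw [MonoidHom.coe_toHomUnits, MonoidHom.coe_toHomUnits] at this
  exact (LinearMap.toMatrixAlgEquiv e).injective this

end Complement

/-! ### Commuting 2 × 2 matrices -/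

section TwoByTwo

variable {k : Type*} [Field k]

/-- A `2 × 2` matrix is scalar. -/
def IsScalar₂ (A : Matrix (Fin 2) (Fin 2) k) : Prop := A 0 1 = 0 ∧ A 1 0 = 0 ∧ A 0 0 = A 1 1

theorem IsScalar₂.eq {A : Matrix (Fin 2) (Fin 2) k} (h : IsScalar₂ A) : A = scalar (Fin 2) (A 0 0) := by
  obtain ⟨h1, h2, h3⟩ := h
  ext i j
  fin_cases i <;> fin_cases j <;> simp [h1, h2, h3]

theorem isScalar₂_scalar (a : k) : IsScalar₂ (scalar (Fin 2) a) := by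
  simp [IsScalar₂]

theorem IsScalar₂.comm {A : Matrix (Fin 2) (Fin 2) k} (h : IsScalar₂ A)
    (B : Matrix (Fin 2) (Fin 2) k) : A * B = B * A := by
  rw [h.eq]
  exact (scalar_commute _ (fun _ ↦ Commute.all _ _) B).eq

/-- A matrix that commutes with a nonscalar matrix `n` is a linear polynomial in `n`. -/
theorem eq_linear_of_comm {n m : Matrix (Fin 2) (Fin 2) k} (hn : ¬ IsScalar₂ n)
    (h : m * n = n * m) : ∃ x y : k, m = scalar (Fin 2) x + y • n := by
  have e00 := congrFun (congrFun h 0) 0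
  have e01 := congrFun (congrFun h 0) 1
  have e10 := congrFun (congrFun h 1) 0
  simp only [mul_apply, Fin.sum_univ_two] at e00 e01 e10
  have key : ∀ y : k, m 0 1 = y * n 0 1 → m 1 0 = y * n 1 0 →
      m 0 0 - m 1 1 = y * (n 0 0 - n 1 1) → ∃ x y : k, m = scalar (Fin 2) x + y • n := by
    intro y h1 h2 h3
    refine ⟨m 0 0 - y * n 0 0, y, ?_⟩
    ext i j
    fin_cases i <;> fin_cases j <;> simp [h1, h2]
    linear_combination -h3
  by_cases h1 : n 0 1 = 0
  · by_cases h2 : n 1 0 = 0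
    · have h3 : n 0 0 - n 1 1 ≠ 0 := fun h3 ↦ hn ⟨h1, h2, sub_eq_zero.1 h3⟩
      refine key ((m 0 0 - m 1 1) / (n 0 0 - n 1 1)) ?_ ?_ (by field_simp)
      · field_simp
        rw [h1] at e01 ⊢
        linear_combination -e01
      · field_simp
        rw [h2] at e10 ⊢
        linear_combination e10
    · refine key (m 1 0 / n 1 0) ?_ (by field_simp) ?_
      · field_simp
        linear_combination e00
      · field_simp
        linear_combination -e10
  · refine key (m 0 1 / n 0 1) (by field_simp) ?_ ?_
    · field_simp
      linear_combination -e00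
    · field_simp
      linear_combination e01

theorem comm_of_comm_nonscalar {n m m' : Matrix (Fin 2) (Fin 2) k} (hn : ¬ IsScalar₂ n)
    (h : m * n = n * m) (h' : m' * n = n * m') : m * m' = m' * m := by
  obtain ⟨x, y, rfl⟩ := eq_linear_of_comm hn h
  obtain ⟨x', y', rfl⟩ := eq_linear_of_comm hn h'
  have hc : ∀ (a : k) (B : Matrix (Fin 2) (Fin 2) k), scalar (Fin 2) a * B = B * scalar (Fin 2) a :=
    fun a B ↦ (isScalar₂_scalar a).comm B
  have e : (y • n) * (y' • n) = (y' • n) * (y • n) := by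
    rw [smul_mul_smul_comm, smul_mul_smul_comm, mul_comm y]
  rw [add_mul, mul_add, mul_add, add_mul, mul_add, mul_add, hc x, hc x, hc x', e, hc x']
  abel

theorem cayley_hamilton₂ (n : Matrix (Fin 2) (Fin 2) k) :
    n * n = n.trace • n - scalar (Fin 2) n.det := by
  ext i j
  fin_cases i <;> fin_cases j <;>
    simp [mul_apply, Fin.sum_univ_two, trace_fin_two, det_fin_two] <;> ring

/-- A nonscalar `2 × 2` matrix of finite order has distinct eigenvalues. -/
theorem discriminant_ne_zero [CharZero k] {n : Matrix (Fin 2) (Fin 2) k} (hn : ¬ IsScalar₂ n)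
    {m : ℕ} (hm : 0 < m) (h : n ^ m = 1) : n.trace ^ 2 - 4 * n.det ≠ 0 := by
  intro hd
  -- With a double eigenvalue `l`, `n = l + ν` and `ν * ν = 0`; the coefficient `(j + 1) * l ^ j` of
  -- `ν` in a power of `n` never vanishes in characteristic zero.
  set l := n.trace / 2 with hl
  have htr : n.trace = 2 * l := by rw [hl]; field_simp
  have hdet : n.det = l ^ 2 := by
    rw [htr] at hd
    have : (4 : k) * n.det = 4 * l ^ 2 := by linear_combination -hd
    exact mul_left_cancel₀ (by norm_num) this
  set ν := n - scalar (Fin 2) l with hν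
  have hnν : n = scalar (Fin 2) l + ν := by rw [hν]; abel
  have hl' : ∀ B : Matrix (Fin 2) (Fin 2) k, scalar (Fin 2) l * B = l • B := fun B ↦ by
    rw [scalar_apply, ← smul_eq_diagonal_mul]
  have hν2 : ν * ν = 0 := by
    have h1 := cayley_hamilton₂ n
    have h2 : n * scalar (Fin 2) l = scalar (Fin 2) l * n := ((isScalar₂_scalar l).comm n).symm
    have h3 : scalar (Fin 2) l * scalar (Fin 2) l = scalar (Fin 2) (l ^ 2) := by
      rw [← map_mul, pow_two]
    rw [hν, sub_mul, mul_sub, mul_sub, h1, h2, h3, hl', hdet, htr, two_mul, add_smul]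
    abel
  have hpow : ∀ j : ℕ, n ^ (j + 1) = scalar (Fin 2) (l ^ (j + 1)) + ((j + 1 : k) * l ^ j) • ν := by
    intro j
    induction j with
    | zero => simpa using hnν
    | succ j ih =>
      rw [pow_succ, ih]
      conv_lhs => enter [2]; rw [hnν]
      rw [add_mul, mul_add, mul_add, ← map_mul, ← pow_succ, smul_mul_assoc, smul_mul_assoc, hν2,
        smul_zero, add_zero, ← (isScalar₂_scalar l).comm ν, hl', scalar_apply (l ^ (j + 1)),
        ← smul_eq_diagonal_mul, smul_smul, add_assoc, ← add_smul]
      congr 2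
      push_cast
      ring
  have hl0 : l ≠ 0 := by
    intro hl0
    have : n.det ^ m = 1 := by rw [← det_pow, h, det_one]
    rw [hdet, hl0] at this
    simp [hm.ne'] at this
  obtain ⟨j, rfl⟩ := Nat.exists_eq_succ_of_ne_zero hm.ne'
  have h1 := (hpow j).symm.trans h
  have hc : ((j : k) + 1) * l ^ j ≠ 0 := mul_ne_zero (Nat.cast_add_one_ne_zero j) (pow_ne_zero _ hl0)
  apply hn
  have e01 := congrFun (congrFun h1 0) 1
  have e10 := congrFun (congrFun h1 1) 0
  have e00 := congrFun (congrFun h1 0) 0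
  have e11 := congrFun (congrFun h1 1) 1
  simp [-mul_eq_zero] at e01 e10 e00 e11
  have f01 := (mul_eq_zero.1 e01).resolve_left hc
  have f10 := (mul_eq_zero.1 e10).resolve_left hc
  have f : ((j : k) + 1) * l ^ j * (ν 0 0 - ν 1 1) = 0 := by linear_combination e00 - e11
  have f00 := (mul_eq_zero.1 f).resolve_left hc
  simp [hν] at f01 f10 f00
  exact ⟨f01, f10, sub_eq_zero.1 f00⟩

/-- A matrix that commutes with `n` and has the same eigenvalues is `n` or its adjugate. -/
theorem eq_or_eq_of_comm [CharZero k] {n m : Matrix (Fin 2) (Fin 2) k} (hn : ¬ IsScalar₂ n)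
    (hdisc : n.trace ^ 2 - 4 * n.det ≠ 0) (h : m * n = n * m) (htr : m.trace = n.trace)
    (hdet : m.det = n.det) : m = n ∨ m = scalar (Fin 2) n.trace - n := by
  obtain ⟨x, y, rfl⟩ := eq_linear_of_comm hn h
  have h1 : 2 * x + y * n.trace = n.trace := by
    refine Eq.trans ?_ htr
    rw [trace_add, trace_smul, scalar_apply, trace_diagonal]
    simp
  have h2 : (scalar (Fin 2) x + y • n).det = x ^ 2 + x * y * n.trace + y ^ 2 * n.det := by
    simp [trace_fin_two, det_fin_two]
    ring
  rw [h2] at hdet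
  have h3 : (y - 1) * (y + 1) * (n.trace ^ 2 - 4 * n.det) = 0 := by
    linear_combination (2 * x + y * n.trace + n.trace) * h1 - 4 * hdet
  rcases mul_eq_zero.1 ((mul_eq_zero.1 h3).resolve_right hdisc) with hy | hy
  · left
    have hy1 : y = 1 := by linear_combination hy
    have hx : x = 0 := by
      subst hy1
      have : 2 * x = 0 := by linear_combination h1
      simpa using this
    rw [hy1, hx]
    simp
  · right
    have hy1 : y = -1 := by linear_combination hy
    have hx : x = n.trace := by
      subst hy1
      have : 2 * x = 2 * n.trace := by linear_combination h1
      exact mul_left_cancel₀ (by norm_num) this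
    rw [hy1, hx, neg_one_smul, sub_eq_add_neg]

/-- Written through matrix units, the product of traces can be summed over a group by averaging each
`single i j 1`; this is how Schur orthogonality enters. -/
theorem trace_mul_trace (A B : Matrix (Fin 2) (Fin 2) k) :
    A.trace * B.trace = ∑ i, ∑ j, (A * single i j 1 * B : Matrix (Fin 2) (Fin 2) k) i j := by
  simp [trace_fin_two, Fin.sum_univ_two, mul_apply, single_apply]
  ring

end TwoByTwo

/-! ### Finite subgroups of GL₂ -/

section FiniteGroups

variable {k : Type*} [Field k] {G : Type*} [Group G]
  {σ : G →* GL (Fin 2) k}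

theorem val_map_mul (σ : G →* GL (Fin 2) k) (g h : G) :
    (σ (g * h) : Matrix (Fin 2) (Fin 2) k) = σ g * σ h := by
  rw [map_mul, Units.val_mul]

theorem comm_of_val_comm (hσ : Function.Injective σ) {g h : G}
    (H : (σ g : Matrix (Fin 2) (Fin 2) k) * σ h = σ h * σ g) : g * h = h * g := by
  apply hσ
  apply Units.ext
  rw [val_map_mul, val_map_mul, H]

theorem trace_conj (σ : G →* GL (Fin 2) k) (g h : G) :
    (σ (g * h * g⁻¹) : Matrix (Fin 2) (Fin 2) k).trace =
      (σ h : Matrix (Fin 2) (Fin 2) k).trace := by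
  rw [map_mul, map_mul, map_inv]
  simpa using trace_units_conj (σ g) (σ h : Matrix (Fin 2) (Fin 2) k)

theorem det_conj (σ : G →* GL (Fin 2) k) (g h : G) :
    (σ (g * h * g⁻¹) : Matrix (Fin 2) (Fin 2) k).det =
      (σ h : Matrix (Fin 2) (Fin 2) k).det := by
  rw [map_mul, map_mul, map_inv]
  simpa using det_units_conj (σ g) (σ h : Matrix (Fin 2) (Fin 2) k)

theorem IsScalar₂.central (hσ : Function.Injective σ) {z : G}
    (hz : IsScalar₂ (σ z : Matrix (Fin 2) (Fin 2) k)) (g : G) : g * z = z * g :=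
  comm_of_val_comm hσ (hz.comm _).symm

/-- By Cayley–Hamilton. It identifies the second alternative of `eq_or_eq_of_comm` with inversion
when the determinant is 1. -/
theorem trace_inv_of_det_eq_one (σ : G →* GL (Fin 2) k) {g : G}
    (hg : (σ g : Matrix (Fin 2) (Fin 2) k).det = 1) :
    (σ g⁻¹ : Matrix (Fin 2) (Fin 2) k) =
      scalar (Fin 2) (σ g : Matrix (Fin 2) (Fin 2) k).trace - σ g := by
  have h1 := cayley_hamilton₂ (σ g : Matrix (Fin 2) (Fin 2) k)
  rw [hg, map_one] at h1
  have h2 : (σ g : Matrix (Fin 2) (Fin 2) k) *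
      (scalar (Fin 2) (σ g : Matrix (Fin 2) (Fin 2) k).trace - σ g) = 1 := by
    rw [mul_sub, h1, ← (isScalar₂_scalar _).comm, scalar_apply, ← smul_eq_diagonal_mul]
    abel
  have h3 : (σ g⁻¹ : Matrix (Fin 2) (Fin 2) k) * σ g = 1 := by
    rw [← val_map_mul, inv_mul_cancel, map_one, Units.val_one]
  calc (σ g⁻¹ : Matrix (Fin 2) (Fin 2) k) = σ g⁻¹ * (σ g *
      (scalar (Fin 2) (σ g : Matrix (Fin 2) (Fin 2) k).trace - σ g)) := by rw [h2, mul_one]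
    _ = _ := by rw [← mul_assoc, h3, one_mul]

variable [CharZero k] [Finite G]

theorem discriminant_map_ne_zero (σ : G →* GL (Fin 2) k) {g : G}
    (hg : ¬ IsScalar₂ (σ g : Matrix (Fin 2) (Fin 2) k)) :
    (σ g : Matrix (Fin 2) (Fin 2) k).trace ^ 2 - 4 * (σ g : Matrix (Fin 2) (Fin 2) k).det ≠ 0 := by
  refine discriminant_ne_zero hg (orderOf_pos g) ?_
  rw [← Units.val_pow_eq_pow_val, ← map_pow, pow_orderOf_eq_one, map_one, Units.val_one]

/-- A subgroup of `GL₂` that is generated by `t` and an abelian normal subset containing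
`t ^ 3` is commutative. -/
theorem comm_of_abelian_by_three (hσ : Function.Injective σ) (N : Set G)
    (hN : ∀ g, ∀ a ∈ N, g * a * g⁻¹ ∈ N) (hcomm : ∀ a ∈ N, ∀ c ∈ N, a * c = c * a) (t : G)
    (ht : t ^ 3 ∈ N) (hgen : ∀ g, ∃ a ∈ N, ∃ i : ℕ, g = a * t ^ i) (g h : G) :
    g * h = h * g := by
  have htN : ∀ a ∈ N, t * a = a * t := by
    intro n hn
    by_cases hsc : IsScalar₂ (σ n : Matrix (Fin 2) (Fin 2) k)
    · exact comm_of_val_comm hσ (hsc.comm _).symm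
    have hm : (σ (t * n * t⁻¹) : Matrix (Fin 2) (Fin 2) k) * σ n = σ n * σ (t * n * t⁻¹) := by
      rw [← val_map_mul, hcomm _ (hN t n hn) _ hn, val_map_mul]
    rcases eq_or_eq_of_comm hsc (discriminant_map_ne_zero σ hsc) hm (trace_conj σ t n)
      (det_conj σ t n) with h1 | h1
    · have := hσ (Units.ext h1)
      rwa [mul_inv_eq_iff_eq_mul] at this
    · exfalso
      have hconj : ∀ x : G, (σ x : Matrix (Fin 2) (Fin 2) k) =
          scalar (Fin 2) (σ n : Matrix (Fin 2) (Fin 2) k).trace - σ n →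
          (σ (t * x * t⁻¹) : Matrix (Fin 2) (Fin 2) k) = σ n := by
        intro x hx
        have e : (σ t : Matrix (Fin 2) (Fin 2) k) * σ t⁻¹ = 1 := by
          rw [← val_map_mul, mul_inv_cancel, map_one, Units.val_one]
        rw [val_map_mul, val_map_mul, hx, mul_sub, sub_mul, ← (isScalar₂_scalar _).comm, mul_assoc,
          e, mul_one, ← val_map_mul, ← val_map_mul, h1, sub_sub_cancel]
      -- Conjugation by `t` exchanges `n` with `tr n - n`, so `t ^ 3` acts on `n` as `t` does. But
      -- `t ^ 3` lies in `N` and commutes with `n`, so the two coincide and `n` is scalar.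
      have h2 := hσ (Units.ext (hconj _ h1))
      have h3 : t ^ 3 * n * (t ^ 3)⁻¹ = t * n * t⁻¹ := by
        calc _ = t * (t * (t * n * t⁻¹) * t⁻¹) * t⁻¹ := by
              simp only [pow_succ, pow_zero, one_mul, _root_.mul_inv_rev, mul_assoc]
          _ = _ := by rw [h2]
      rw [hcomm _ ht _ hn, mul_inv_cancel_right] at h3
      rw [← h3] at h1
      apply hsc
      have e01 := congrFun (congrFun h1 0) 1
      have e10 := congrFun (congrFun h1 1) 0
      have e00 := congrFun (congrFun h1 0) 0
      simp [trace_fin_two] at e01 e10 e00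
      exact ⟨self_eq_neg.1 e01, self_eq_neg.1 e10, e00⟩
  have htN' : ∀ a ∈ N, ∀ i : ℕ, t ^ i * a = a * t ^ i := fun a ha i ↦
    (Commute.pow_left (show Commute t a from htN a ha) i).eq
  obtain ⟨a, ha, i, rfl⟩ := hgen g
  obtain ⟨c, hc, j, rfl⟩ := hgen h
  calc a * t ^ i * (c * t ^ j) = a * (t ^ i * c) * t ^ j := by group
    _ = (a * c) * (t ^ i * t ^ j) := by rw [htN' c hc]; group
    _ = (c * a) * (t ^ j * t ^ i) := by rw [hcomm a ha c hc, ← pow_add, ← pow_add, add_comm]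
    _ = c * (a * t ^ j) * t ^ i := by group
    _ = c * t ^ j * (a * t ^ i) := by rw [← htN' a ha]; group

/-- A nontrivial finite group of odd order in `SL₂` commutes with a nonscalar matrix. -/
theorem exists_nonscalar_commutant [Nontrivial G] (hσ : Function.Injective σ)
    (hdet : ∀ g, (σ g : Matrix (Fin 2) (Fin 2) k).det = 1) (hodd : Odd (Nat.card G)) :
    ∃ m : Matrix (Fin 2) (Fin 2) k, ¬ IsScalar₂ m ∧
      ∀ g, (σ g : Matrix (Fin 2) (Fin 2) k) * m = m * σ g := by
  have := Fintype.ofFinite G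
  -- Otherwise the representation behaves as an irreducible one: `∑ tr g * tr g⁻¹ = |G|` and `∑ tr g
  -- = 0`. Squaring is a bijection in odd order, and `tr (g ^ 2) = tr g * tr g⁻¹ - 2` for
  -- determinant 1, so summing gives `0 = |G| - 2 * |G|`.
  by_contra! hcon
  replace hcon : ∀ m : Matrix (Fin 2) (Fin 2) k,
      (∀ g, (σ g : Matrix (Fin 2) (Fin 2) k) * m = m * σ g) → IsScalar₂ m := by
    intro m hm
    by_contra hs
    obtain ⟨g, hg⟩ := hcon m hs
    exact hg (hm g)
  have hinv : ∀ g, (σ g⁻¹ : Matrix (Fin 2) (Fin 2) k) * σ g = 1 := fun g ↦ by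
    rw [← val_map_mul, inv_mul_cancel, map_one, Units.val_one]
  let P : Matrix (Fin 2) (Fin 2) k → Matrix (Fin 2) (Fin 2) k := fun X ↦ ∑ g, σ g * X * σ g⁻¹
  have hP : ∀ X, IsScalar₂ (P X) := by
    refine fun X ↦ hcon _ fun h ↦ ?_
    simp only [P]
    conv_rhs => rw [← Equiv.sum_comp (Equiv.mulLeft h)]
    rw [Finset.sum_mul, Finset.mul_sum]
    refine Finset.sum_congr rfl fun g _ ↦ ?_
    rw [Equiv.coe_mulLeft, _root_.mul_inv_rev, val_map_mul, val_map_mul]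
    simp only [mul_assoc]
    rw [hinv, mul_one]
  have hPtr : ∀ X, (P X).trace = Fintype.card G * X.trace := by
    intro X
    simp only [P]
    rw [trace_sum, Finset.sum_congr rfl fun g _ ↦ by
      rw [trace_mul_comm, ← mul_assoc, hinv, one_mul], Finset.sum_const, Finset.card_univ,
      nsmul_eq_mul]
  have h1 : ∑ g, (σ g : Matrix (Fin 2) (Fin 2) k).trace *
      (σ g⁻¹ : Matrix (Fin 2) (Fin 2) k).trace = Fintype.card G := by
    have e2 : ∀ i j, ∑ g, ((σ g : Matrix (Fin 2) (Fin 2) k) * single i j 1 *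
        (σ g⁻¹ : Matrix (Fin 2) (Fin 2) k) : Matrix (Fin 2) (Fin 2) k) i j =
        P (single i j 1) i j := by
      intro i j
      simp only [P, Matrix.sum_apply]
    rw [Finset.sum_congr rfl fun g _ ↦ trace_mul_trace _ _, Finset.sum_comm]
    rw [Finset.sum_congr rfl fun i _ ↦ Finset.sum_comm]
    simp only [e2, Fin.sum_univ_two]
    have t0 := hPtr (single 0 0 1)
    have t1 := hPtr (single 1 1 1)
    obtain ⟨-, -, d0⟩ := hP (single 0 0 1)
    obtain ⟨-, -, d1⟩ := hP (single 1 1 1)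
    rw [(hP (single 0 1 1)).1, (hP (single 1 0 1)).2.1]
    rw [trace_fin_two, trace_fin_two] at t0 t1
    simp at t0 t1
    have h2 : (2 : k) * (P (single 0 0 1) 0 0 + 0 + (0 + P (single 1 1 1) 1 1)) =
        2 * Fintype.card G := by linear_combination t0 + t1 + d0 - d1
    exact mul_left_cancel₀ (by norm_num) h2
  have h2 : ∑ g, (σ g : Matrix (Fin 2) (Fin 2) k).trace = 0 := by
    set E : Matrix (Fin 2) (Fin 2) k := ∑ g, (σ g : Matrix (Fin 2) (Fin 2) k) with hE
    have hl : ∀ h, (σ h : Matrix (Fin 2) (Fin 2) k) * E = E := by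
      intro h
      rw [hE, Finset.mul_sum, ← Equiv.sum_comp (Equiv.mulLeft h)
        (fun g ↦ (σ g : Matrix (Fin 2) (Fin 2) k))]
      exact Finset.sum_congr rfl fun g _ ↦ by rw [Equiv.coe_mulLeft, val_map_mul]
    have hr : ∀ h, E * (σ h : Matrix (Fin 2) (Fin 2) k) = E := by
      intro h
      rw [hE, Finset.sum_mul, ← Equiv.sum_comp (Equiv.mulRight h)
        (fun g ↦ (σ g : Matrix (Fin 2) (Fin 2) k))]
      exact Finset.sum_congr rfl fun g _ ↦ by rw [Equiv.coe_mulRight, val_map_mul]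
    have hs := (hcon E fun h ↦ by rw [hl, hr]).eq
    rw [← trace_sum, ← hE]
    obtain ⟨h, hh⟩ := exists_ne (1 : G)
    have h3 := hr h
    by_cases he : E 0 0 = 0
    · rw [hs, he]
      simp
    · exfalso
      apply hh
      apply hσ
      apply Units.ext
      rw [hs, scalar_apply, ← smul_eq_diagonal_mul, ← scalar_apply] at h3
      rw [map_one, Units.val_one]
      have h4 : E 0 0 • (σ h : Matrix (Fin 2) (Fin 2) k) = E 0 0 • 1 := by
        rw [h3, smul_one_eq_diagonal, scalar_apply]
      exact smul_right_injective _ he h4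
  have h3 : ∑ g, (σ g : Matrix (Fin 2) (Fin 2) k).trace =
      ∑ g, ((σ g : Matrix (Fin 2) (Fin 2) k).trace * (σ g⁻¹ : Matrix (Fin 2) (Fin 2) k).trace - 2) := by
    rw [← Equiv.sum_comp (powCoprime (n := 2) (by simpa using hodd))]
    refine Finset.sum_congr rfl fun g _ ↦ ?_
    rw [powCoprime_apply, pow_two, val_map_mul, cayley_hamilton₂, trace_inv_of_det_eq_one σ (hdet g),
      hdet, trace_sub, trace_sub, trace_smul, scalar_apply, scalar_apply, trace_diagonal,
      trace_diagonal, Fin.sum_univ_two, Fin.sum_univ_two, smul_eq_mul]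
    ring
  rw [Finset.sum_sub_distrib, h1, h2] at h3
  simp at h3
  have h4 : (Fintype.card G : k) = 0 := by linear_combination h3
  exact Fintype.card_ne_zero (Nat.cast_eq_zero.1 h4)

/-- A nontrivial finite subgroup of `GL₂` has a nontrivial element which every element centralizes
or inverts. -/
theorem exists_centralized_or_inverted [Nontrivial G] (hσ : Function.Injective σ) :
    ∃ h : G, h ≠ 1 ∧ ∀ g, g * h * g⁻¹ = h ∨ g * h * g⁻¹ = h⁻¹ := by
  by_cases hsc : ∃ h : G, h ≠ 1 ∧ IsScalar₂ (σ h : Matrix (Fin 2) (Fin 2) k)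
  · obtain ⟨h, h1, hs⟩ := hsc
    exact ⟨h, h1, fun g ↦ Or.inl (by rw [hs.central hσ g, mul_inv_cancel_right])⟩
  push Not at hsc
  let δ : G →* kˣ := GeneralLinearGroup.det.comp σ
  have hδ : ∀ g, δ g = 1 ↔ (σ g : Matrix (Fin 2) (Fin 2) k).det = 1 := fun g ↦ by
    rw [Units.ext_iff]
    rfl
  by_cases hH : δ.ker = ⊥
  · obtain ⟨h, hh⟩ := exists_ne (1 : G)
    refine ⟨h, hh, fun g ↦ Or.inl ((MonoidHom.ker_eq_bot_iff δ).1 hH ?_)⟩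
    rw [map_mul, map_mul, map_inv, mul_comm (δ g), mul_inv_cancel_right]
  have hnt : Nontrivial δ.ker := (Subgroup.nontrivial_iff_ne_bot _).2 hH
  -- An involution of determinant 1 in GL₂ is scalar, and nontrivial scalars have been excluded.
  have hodd : Odd (Nat.card δ.ker) := by
    by_contra hodd
    rw [Nat.not_odd_iff_even, even_iff_two_dvd] at hodd
    obtain ⟨x, hx⟩ := exists_prime_orderOf_dvd_card' 2 hodd
    have hx1 : (x : G) ≠ 1 := by
      intro h1
      rw [show x = 1 from Subtype.ext h1, orderOf_one] at hx
      norm_num at hx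
    apply hsc x hx1
    have h2 : (x : G) * x = 1 := by
      have := pow_orderOf_eq_one x
      rw [hx, pow_two] at this
      exact congrArg Subtype.val this
    have h3 := cayley_hamilton₂ (σ x : Matrix (Fin 2) (Fin 2) k)
    rw [← val_map_mul, h2, (hδ _).1 x.2, map_one, map_one, Units.val_one] at h3
    have e01 := congrFun (congrFun h3 0) 1
    have e10 := congrFun (congrFun h3 1) 0
    have e00 := congrFun (congrFun h3 0) 0
    have e11 := congrFun (congrFun h3 1) 1
    simp only [Matrix.sub_apply, Matrix.smul_apply, smul_eq_mul, one_apply_eq, one_apply_ne, ne_eq,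
      Fin.isValue, zero_ne_one, one_ne_zero, not_false_eq_true, sub_zero] at e01 e10 e00 e11
    have ht : (σ x : Matrix (Fin 2) (Fin 2) k).trace ≠ 0 := by
      intro ht
      rw [ht] at e00
      have : (2 : k) = 0 := by linear_combination e00
      norm_num at this
    exact ⟨(mul_eq_zero.1 e01.symm).resolve_left ht, (mul_eq_zero.1 e10.symm).resolve_left ht,
      mul_left_cancel₀ ht (by linear_combination e11 - e00)⟩
  obtain ⟨m, hm, hcomm⟩ := exists_nonscalar_commutant (σ := σ.comp δ.ker.subtype)
    (hσ.comp Subtype.val_injective) (fun g ↦ (hδ _).1 g.2) hodd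
  obtain ⟨h, hh⟩ := exists_ne (1 : δ.ker)
  have hh' : (h : G) ≠ 1 := fun h1 ↦ hh (Subtype.ext h1)
  refine ⟨h, hh', fun g ↦ ?_⟩
  have hg : g * h * g⁻¹ ∈ δ.ker := δ.normal_ker.conj_mem h h.2 g
  have hcm : (σ (g * h * g⁻¹) : Matrix (Fin 2) (Fin 2) k) * σ h = σ h * σ (g * h * g⁻¹) :=
    comm_of_comm_nonscalar hm (hcomm ⟨_, hg⟩) (hcomm h)
  have hns := hsc h hh'
  rcases eq_or_eq_of_comm hns (discriminant_map_ne_zero σ hns) hcm (trace_conj σ g h)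
    (det_conj σ g h) with h1 | h1
  · exact Or.inl (hσ (Units.ext h1))
  · right
    rw [← trace_inv_of_det_eq_one σ ((hδ _).1 h.2)] at h1
    exact hσ (Units.ext h1)

/-- If a finite subgroup of `GL₂` contains `C₃²`, then it has a nontrivial center. -/
theorem exists_central_of_three_torsion [IsAlgClosed k] (hσ : Function.Injective σ) {h t : G}
    (hht : h * t = t * h) (hh : h ^ 3 = 1) (ht : t ^ 3 = 1) (h1 : h ≠ 1) (hne : ∀ j : ℕ, t ≠ h ^ j) :
    ∃ z : G, z ≠ 1 ∧ ∀ g, g * z = z * g := by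
  let s : Fin 2 → G := ![h, t]
  have hs : ∀ i j, s i * s j = s j * s i := by
    intro i j
    fin_cases i <;> fin_cases j <;> simp [s, hht]
  obtain ⟨b, χ, hχ⟩ := exists_common_eigenbasis (fun i ↦ σ (s i))
    (fun i j ↦ by rw [← map_mul, hs, map_mul])
    (fun i ↦ (ProjGenLinGroup.mk.comp σ).isOfFinOrder (isOfFinOrder_of_finite (s i)))
  have hs3 : ∀ i, s i ^ 3 = 1 := by
    intro i
    fin_cases i <;> simp [s, hh, ht]
  have hχ3 : ∀ i j, χ i j ^ 3 = 1 := by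
    intro i j
    have := pow_smul_eigenvector (hχ i j) 3
    rw [← map_pow, hs3, map_one, one_smul] at this
    exact (smul_left_injective k (b.ne_zero j) (this.symm.trans (one_smul _ _).symm))
  have hχ0 : ∀ i j, χ i j ≠ 0 := fun i j ↦ eigenvalue_ne_zero (b.ne_zero j) (hχ i j)
  have central : ∀ z : G, (∃ c : k, ∀ i, σ z • b i = c • b i) → ∀ g, g * z = z * g := by
    rintro z ⟨c, hc⟩ g
    apply hσ
    refine gl_ext_basis (Pi.basisFun k (Fin 2)) fun i ↦ ?_
    have hz : ∀ v : Fin 2 → k, σ z • v = c • v := by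
      intro v
      rw [← b.sum_repr v, Finset.smul_sum, Finset.smul_sum]
      exact Finset.sum_congr rfl fun j _ ↦ by rw [smul_comm, hc, smul_comm]
    rw [map_mul, map_mul, mul_smul, mul_smul, hz, hz, smul_comm]
  have hr3 : ∀ i, (χ i 0 / χ i 1) ^ 3 = 1 := fun i ↦ by
    rw [div_pow, hχ3, hχ3, div_one]
  -- The eigenvalue ratios of `h` and `t` are cube roots of unity. Either that of `h` is 1, or that
  -- of `t` is its `j`-th power and `t * h ^ (2 * j)`, which is `t * h⁻ʲ`, is scalar.
  by_cases hr : χ 0 0 / χ 0 1 = 1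
  · refine ⟨h, h1, central h ⟨χ 0 0, fun i ↦ ?_⟩⟩
    have := hχ 0 i
    rw [div_eq_one_iff_eq (hχ0 _ _)] at hr
    fin_cases i
    · exact this
    · exact this.trans (by rw [hr]; rfl)
  · obtain ⟨j, -, hj⟩ := exists_pow_eq_of_cube_eq_one (hr3 0) (hr3 1) hr
    refine ⟨t * h ^ (2 * j), fun hz ↦ hne j ?_, central _ ⟨χ 1 0 * χ 0 0 ^ (2 * j), fun i ↦ ?_⟩⟩
    · rw [← mul_left_inj (h ^ (2 * j)), hz, ← pow_add, show j + 2 * j = 3 * j by ring, pow_mul, hh,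
        one_pow]
    · have e : ∀ i, σ (t * h ^ (2 * j)) • b i = (χ 1 i * χ 0 i ^ (2 * j)) • b i := by
        intro i
        have e0 := pow_smul_eigenvector (hχ 0 i) (2 * j)
        have e1 := hχ 1 i
        simp only [s, cons_val_zero, cons_val_one] at e0 e1
        rw [map_mul, map_pow, mul_smul, e0, smul_comm, e1, smul_smul, mul_comm]
      have e2 : χ 1 0 * χ 0 0 ^ (2 * j) = χ 1 1 * χ 0 1 ^ (2 * j) := by
        have p0 : χ 0 0 ^ (3 * j) = 1 := by rw [pow_mul, hχ3, one_pow]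
        have p1 : χ 0 1 ^ (3 * j) = 1 := by rw [pow_mul, hχ3, one_pow]
        rw [div_pow, div_eq_div_iff (hχ0 _ _) (pow_ne_zero _ (hχ0 _ _))] at hj
        have q : χ 0 1 ^ j ≠ 0 := pow_ne_zero _ (hχ0 _ _)
        apply mul_right_cancel₀ q
        calc χ 1 0 * χ 0 0 ^ (2 * j) * χ 0 1 ^ j = (χ 1 0 * χ 0 1 ^ j) * χ 0 0 ^ (2 * j) := by ring
          _ = χ 0 0 ^ (3 * j) * χ 1 1 := by rw [hj]; ring
          _ = χ 1 1 * χ 0 1 ^ (3 * j) := by rw [p0, p1]; ring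
          _ = χ 1 1 * χ 0 1 ^ (2 * j) * χ 0 1 ^ j := by ring
      rw [e]
      fin_cases i
      · rfl
      · exact congrArg (· • b 1) e2.symm

end FiniteGroups

/-! ### Comparing two actions of the same group -/

section Types

variable {k : Type*} [Field k] {G : Type*} [Group G] {M : G → GL (Fin 3) k}
  {φ ψ : G →* PGL(3, k)}

/-- The scalars by which lifts commute with the lift of a central element. -/
theorem IsLift.exists_comm_hom (hM : IsLift M φ) {z : G} (hz : ∀ g, g * z = z * g) :
    ∃ p : G →* k, ∀ g, ∀ v : Fin 3 → k, M z • M g • v = p g • M g • M z • v := by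
  have h0 : ∀ g, ∃ c : k, ∀ v : Fin 3 → k, M z • M g • v = c • M g • M z • v := fun g ↦ by
    obtain ⟨c, -, hc⟩ := hM.swap (hz g).symm
    exact ⟨c, hc⟩
  choose p hp using h0
  have huniq : ∀ g c, (∀ v : Fin 3 → k, M z • M g • v = c • M g • M z • v) → p g = c := by
    intro g c hc
    let b := Pi.basisFun k (Fin 3)
    have hne : M g • M z • b 0 ≠ 0 :=
      (smul_ne_zero_iff_ne _).2 ((smul_ne_zero_iff_ne _).2 (b.ne_zero 0))
    exact smul_left_injective k hne ((hp g (b 0)).symm.trans (hc _))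
  refine ⟨⟨⟨p, huniq 1 1 fun v ↦ ?_⟩, fun g h ↦ huniq _ _ fun v ↦ ?_⟩, hp⟩
  · obtain ⟨d, -, hd⟩ := hM.one
    rw [hd, hd, one_smul, smul_comm]
  · exact hM.swap_mul _ _ (hp g) (hp h) v

/-- If a finite group has an action with a fixed point and an action without one, then it is
`C₃²` and the second action has an orbit of length `3`. -/
theorem fixesPoint_and_not_fixesPoint [IsAlgClosed k] [CharZero k] [Finite G]
    (hφ : Function.Injective φ) (hψ : Function.Injective ψ) (hφp : FixesPoint φ)
    (hψp : ¬ FixesPoint ψ) : HasOrbitOfLengthThree ψ ∧ Nonempty (G ≃* C3Squared) := by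
  obtain ⟨M, hM⟩ := exists_isLift ψ
  obtain ⟨σ, hσ⟩ := exists_embedding_GL_two hφ hφp
  have hnt : Nontrivial G := by
    by_contra hG
    rw [not_nontrivial_iff_subsingleton] at hG
    refine hψp ⟨Projectivization.mk k (Pi.basisFun k (Fin 3) 0) ((Pi.basisFun k _).ne_zero 0),
      fun g ↦ ?_⟩
    rw [Subsingleton.elim g 1, map_one, one_smul]
  obtain ⟨h, h1, hh⟩ := exists_centralized_or_inverted hσ
  obtain ⟨horb, t, ht, hne⟩ := hM.exists_noncommuting hψ hψp h1 hh
  refine ⟨horb, ?_⟩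
  obtain ⟨z, hz1, hz⟩ := exists_central_of_three_torsion hσ ht.symm
    (hM.cube_eq_one hψ ht.symm hne.symm) (hM.cube_eq_one hψ ht hne) h1 (hM.ne_pow hne.symm)
  obtain ⟨-, s, hs, hsne⟩ := hM.exists_noncommuting hψ hψp hz1
    fun g ↦ Or.inl (by rw [hz, mul_inv_cancel_right])
  obtain ⟨p, hp⟩ := hM.exists_comm_hom hz
  have hps := comm_ne_one hsne.symm (hp s)
  have hp3 : ∀ g, p g ^ 3 = 1 := fun g ↦ cube_eq_one_of_comm (hp g)
  obtain ⟨b, β, γ, hβ, hγ, hB, hC⟩ := exists_heisenberg_basis hps (hp s)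
  have hdiag : ∀ a, p a = 1 → ∃ d : Fin 3 → k, ∀ i, M a • b i = d i • b i := by
    intro a ha
    have h3 : ∀ i, ∃ c : k, M a • b i = c • b i := by
      intro i
      have h4 := hp a (b i)
      rw [ha, one_smul, hB, smul_comm (M a)] at h4
      exact ⟨_, eq_smul_of_repr b fun l hl ↦ (pow_fin_injective (hp3 s) hps (mul_left_cancel₀ hβ
        (eigenvalue_eq_of_repr_ne_zero b hB h4 hl))).symm⟩
    choose d hd using h3
    exact ⟨d, hd⟩
  -- The kernel of `p` is diagonal in the basis `b`, hence abelian; since `p s` is a primitive cube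
  -- root of unity, the powers of `s` meet every coset of that kernel.
  have hG : ∀ g h : G, g * h = h * g := by
    refine comm_of_abelian_by_three hσ {a | p a = 1} ?_ ?_ s ?_ ?_
    · intro g a ha
      have hg : p g * p g⁻¹ = 1 := by rw [← map_mul, mul_inv_cancel, map_one]
      rw [Set.mem_ofPred_eq] at ha ⊢
      rw [map_mul, map_mul, ha, mul_one, hg]
    · intro a ha c hc
      obtain ⟨d, hd⟩ := hdiag a ha
      obtain ⟨e, he⟩ := hdiag c hc
      refine hM.comm_of_lift_comm hψ (gl_ext_basis b fun i ↦ ?_)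
      rw [mul_smul, mul_smul, hd, he, smul_comm (M a), smul_comm (M c), hd, he, smul_comm]
    · rw [Set.mem_ofPred_eq, map_pow, hp3]
    · intro g
      obtain ⟨i, -, hi⟩ := exists_pow_eq_of_cube_eq_one (hp3 s) (hp3 g) hps
      refine ⟨g * (s ^ i)⁻¹, ?_, i, by group⟩
      have h4 : p (g * (s ^ i)⁻¹) * p s ^ i = 1 * p s ^ i := by
        rw [← map_pow, ← map_mul, inv_mul_cancel_right, hi, map_pow, one_mul]
      refine mul_right_cancel₀ (pow_ne_zero i fun h0 ↦ ?_) h4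
      have := hp3 s
      rw [h0] at this
      norm_num at this
  obtain ⟨e⟩ := closure_pair_equiv (hG z s) (hM.cube_eq_one hψ (hG z s) hsne.symm)
    (hM.cube_eq_one hψ (hG s z) hsne) hz1 (hM.ne_pow hsne.symm)
  rw [hM.closure_eq_top hψ hG hsne.symm] at e
  exact ⟨Subgroup.topEquiv.symm.trans e⟩

/-- An orbit of length `3` spans the plane if no point is fixed. -/
theorem IsLift.exists_permutesLines_of_orbit [CharZero k] [Finite G] (hM : IsLift M φ)
    (hφ : ¬ FixesPoint φ) (horb : HasOrbitOfLengthThree φ) :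
    ∃ b : Basis (Fin 3) k (Fin 3 → k), PermutesLines M b := by
  obtain ⟨p, hp⟩ := horb
  obtain ⟨x, y, z, hxy, hxz, hyz, hrange⟩ := Set.ncard_eq_three.1 hp
  let q : Fin 3 → ℙ k (Fin 3 → k) := ![x, y, z]
  have hq : ∀ r, r ∈ Set.range (fun g ↦ φ g • p) ↔ ∃ i, r = q i := by
    intro r
    rw [hrange]
    simp [Fin.exists_fin_succ, q]
  have hperm : ∀ g i, ∃ j, ∃ c : k, M g • (q i).rep = c • (q j).rep := by
    intro g i
    obtain ⟨h, hh⟩ := (hq (q i)).2 ⟨i, rfl⟩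
    obtain ⟨j, hj⟩ := (hq (φ g • q i)).1 ⟨g * h, by
      simp only [map_mul, mul_smul] at hh ⊢
      rw [hh]⟩
    refine ⟨j, (hM.smul_mk_eq_iff g (q i).rep_nonzero (q j).rep_nonzero).1 ?_⟩
    rw [Projectivization.mk_rep, Projectivization.mk_rep, hj]
  let W := Submodule.span k (Set.range fun i ↦ (q i).rep)
  have hW : ∀ g, ∀ w ∈ W, M g • w ∈ W := by
    intro g w hw
    induction hw using Submodule.span_induction with
    | mem w hw =>
      obtain ⟨i, rfl⟩ := hw
      obtain ⟨j, c, h⟩ := hperm g i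
      simp only [h]
      exact W.smul_mem _ (Submodule.subset_span ⟨j, rfl⟩)
    | zero => rw [smul_zero]; exact W.zero_mem
    | add u v _ _ hu hv => rw [smul_add]; exact W.add_mem hu hv
    | smul c u _ hu => rw [smul_comm]; exact W.smul_mem _ hu
  by_cases htop : W = ⊤
  · let b := basisOfTopLeSpanOfCardEqFinrank (fun i ↦ (q i).rep) htop.ge (by simp)
    have hb : ∀ i, b i = (q i).rep := fun i ↦ by simp [b]
    exact ⟨b, hM.permutesLines hφ fun g i ↦ by simpa only [hb] using hperm g i⟩
  -- Three collinear points would span a plane `W` in `k³`, and its invariant complement would be a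
  -- fixed point.
  exfalso
  obtain ⟨W', hWW', hW'⟩ := hM.exists_invariant_compl W hW
  have hadd := Submodule.finrank_add_eq_of_isCompl hWW'
  rw [Module.finrank_fin_fun] at hadd
  have hlt := Submodule.finrank_lt (lt_top_iff_ne_top.2 htop).ne
  rw [Module.finrank_fin_fun] at hlt
  have h2 : 2 ≤ finrank k W := by
    have hli := Projectivization.linearIndependent_pair_iff_ne.2 hxy
    have h3 := finrank_span_eq_card hli
    rw [Fintype.card_fin] at h3
    refine h3.symm.le.trans ?_
    refine Submodule.finrank_mono (Submodule.span_mono ?_)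
    rintro _ ⟨i, rfl⟩
    fin_cases i
    · exact ⟨0, rfl⟩
    · exact ⟨1, rfl⟩
  have h1 : finrank k W' = 1 := by omega
  obtain ⟨v, hv, hall⟩ := finrank_eq_one_iff'.1 h1
  refine hφ (hM.fixesPoint_iff.2 ⟨v, fun h0 ↦ hv (Subtype.ext h0), fun g ↦ ?_⟩)
  obtain ⟨c, hc⟩ := hall ⟨M g • v, hW' g v v.2⟩
  exact ⟨c, (congrArg Subtype.val hc).symm⟩

theorem IsLift.exists_perm_hom (hM : IsLift M φ) {b : Basis (Fin 3) k (Fin 3 → k)}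
    (hb : PermutesLines M b) :
    ∃ (π : G →* Equiv.Perm (Fin 3)), ∀ g i, ∃ c : k, c ≠ 0 ∧ M g • b i = c • b (π g i) := by
  choose π c hπ using hb.1
  have hne : ∀ g i, M g • b i ≠ 0 := fun g i ↦ (smul_ne_zero_iff_ne _).2 (b.ne_zero i)
  have h1 : ∀ i, π 1 i = i := by
    intro i
    obtain ⟨d, -, hd⟩ := hM.one
    exact eq_of_smul_basis_eq (hne 1 i) (hπ 1 i) (hd (b i))
  have hmul : ∀ g h i, π (g * h) i = π g (π h i) := by
    intro g h i
    obtain ⟨d, -, hd⟩ := hM.mul g h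
    refine eq_of_smul_basis_eq (hne (g * h) i) (hπ (g * h) i) (y := d * (c h i * c g (π h i))) ?_
    rw [hd, hπ, smul_comm (M g), hπ, smul_smul, smul_smul, mul_assoc]
  refine ⟨⟨⟨fun g ↦ ⟨π g, π g⁻¹, fun i ↦ ?_, fun i ↦ ?_⟩, ?_⟩, fun g h ↦ ?_⟩, fun g i ↦
    ⟨c g i, fun h0 ↦ ?_, hπ g i⟩⟩
  · rw [← hmul, inv_mul_cancel, h1]
  · rw [← hmul, mul_inv_cancel, h1]
  · ext i
    simp [h1]
  · ext i
    simp [hmul]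
  · apply hne g i
    rw [hπ, h0, zero_smul]

/-- A transitive subgroup of S₃ contains a 3-cycle: if `s` and `s'` are both transpositions, `s⁻¹ *
s'` is one. Every permutation centralizes or inverts a 3-cycle. -/
theorem perm_three_cases (s s' : Equiv.Perm (Fin 3)) (hs : s 0 = 1) (hs' : s' 0 = 2) :
    ∃ r : Equiv.Perm (Fin 3), (r = s ∨ r = s' ∨ r = s⁻¹ * s') ∧ r ≠ 1 ∧
      ∀ u, u * r * u⁻¹ = r ∨ u * r * u⁻¹ = r⁻¹ := by
  revert s s'
  decide

/-- Every permutation of ℤ/3 has the form `j ↦ d ± j`. On the eigenvalues `ω ^ j` it therefore acts,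
up to a scalar, trivially or by inversion. -/
theorem perm_three_affine : ∀ s : Equiv.Perm (Fin 3),
    (∃ d, ∀ j, s j = j + d) ∨ (∃ d, ∀ j, s j + j = d) := by
  decide

/-- An element that acts as `diag(1, ω, ω²)` on a permuted basis is centralized or inverted by
every element. -/
theorem IsLift.conj_eq_or_eq_inv (hM : IsLift M φ) (hφ : Function.Injective φ)
    {b : Basis (Fin 3) k (Fin 3 → k)} (hb : PermutesLines M b) {z : G} {ν ω : k} (hν : ν ≠ 0)
    (hω : ω ^ 3 = 1) (hz : ∀ i : Fin 3, M z • b i = (ν * ω ^ (i : ℕ)) • b i) (g : G) :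
    g * z * g⁻¹ = z ∨ g * z * g⁻¹ = z⁻¹ := by
  obtain ⟨π, hπ⟩ := hM.exists_perm_hom hb
  have hω0 : ω ≠ 0 := by
    rintro rfl
    norm_num at hω
  obtain ⟨c, hc, hconj⟩ := hM.conj (g * z * g⁻¹) g
  rw [show g⁻¹ * (g * z * g⁻¹) * g = z by group] at hconj
  have key : ∀ j : Fin 3, M (g * z * g⁻¹) • b j = (c * (ν * ω ^ (((π g)⁻¹ j : Fin 3) : ℕ))) • b j := by
    intro j
    obtain ⟨d, hd, hdj⟩ := hπ g ((π g)⁻¹ j)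
    rw [show π g ((π g)⁻¹ j) = j from Equiv.apply_symm_apply _ _] at hdj
    have h1 : M (g * z * g⁻¹) • d • b j =
        (c * (ν * ω ^ (((π g)⁻¹ j : Fin 3) : ℕ))) • d • b j := by
      rw [← hdj, hconj, hz, smul_comm (M g), smul_smul]
    rw [smul_comm, smul_comm _ d] at h1
    exact smul_right_injective _ hd h1
  rcases perm_three_affine (π g)⁻¹ with ⟨s, hs⟩ | ⟨s, hs⟩
  · left
    apply hφ
    rw [← hM, ← hM]
    refine mk_eq_mk_of_basis b (mul_ne_zero hc (pow_ne_zero (s : ℕ) hω0)) fun j ↦ ?_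
    rw [key, hs, pow_fin_add hω, hz, smul_smul]
    congr 1
    ring
  · right
    rw [eq_inv_iff_mul_eq_one]
    obtain ⟨d, hd, hmul⟩ := hM.mul (g * z * g⁻¹) z
    refine hM.eq_one hφ b (c := d * c * ν ^ 2 * ω ^ (s : ℕ)) (by positivity) fun j ↦ ?_
    rw [hmul, hz, smul_comm (M _), key, ← hs j, pow_fin_add hω, smul_smul, smul_smul]
    congr 1
    ring

theorem hasOrbitOfLengthThree_of_hasOrbitOfLengthThree [IsAlgClosed k] [CharZero k] [Finite G]
    (hφ : Function.Injective φ) (hψ : Function.Injective ψ) (hφp : ¬ FixesPoint φ)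
    (hψp : ¬ FixesPoint ψ) (horb : HasOrbitOfLengthThree φ) : HasOrbitOfLengthThree ψ := by
  obtain ⟨L, hL⟩ := exists_isLift φ
  obtain ⟨M, hM⟩ := exists_isLift ψ
  obtain ⟨b, hb⟩ := hL.exists_permutesLines_of_orbit hφp horb
  let A : Set G := {a | ∀ i, ∃ c : k, L a • b i = c • b i}
  have hAconj : ∀ g, ∀ a ∈ A, g⁻¹ * a * g ∈ A := by
    intro g a ha i
    obtain ⟨c, hc, h⟩ := hL.conj a g
    obtain ⟨j, x, hx⟩ := hb.1 g i
    obtain ⟨y, hy⟩ := ha j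
    have h1 : L g • L (g⁻¹ * a * g) • b i = L g • (c⁻¹ * y) • b i := by
      have h2 := h (b i)
      rw [hx, smul_comm (L a), hy, smul_comm x, ← hx, eq_comm, ← eq_inv_smul_iff₀ hc] at h2
      rw [h2, smul_comm (L g), smul_smul]
    exact ⟨_, smul_left_cancel _ h1⟩
  have hAcomm : ∀ a ∈ A, ∀ c ∈ A, a * c = c * a := by
    intro a ha c hc
    refine hL.comm_of_lift_comm hφ (gl_ext_basis b fun i ↦ ?_)
    obtain ⟨x, hx⟩ := ha i
    obtain ⟨y, hy⟩ := hc i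
    rw [mul_smul, mul_smul, hx, hy, smul_comm (L a), smul_comm (L c), hx, hy, smul_comm]
  by_cases hA : ∀ a ∈ A, a = 1
  -- Without diagonal elements `G` embeds in S₃ as a transitive subgroup, and a 3-cycle is the
  -- element sought.
  · obtain ⟨π, hπ⟩ := hL.exists_perm_hom hb
    have hπinj : Function.Injective π := by
      rw [injective_iff_map_eq_one]
      intro g hg
      refine hA g fun i ↦ ?_
      obtain ⟨c, -, h⟩ := hπ g i
      exact ⟨c, by rw [h, hg]; rfl⟩
    have htrans : ∀ j, ∃ g, π g 0 = j := by
      intro j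
      obtain ⟨g, c, hg⟩ := hb.2 0 j
      obtain ⟨d, hd, hgd⟩ := hπ g 0
      exact ⟨g, eq_of_smul_basis_eq ((smul_ne_zero_iff_ne _).2 (b.ne_zero 0)) hgd hg⟩
    obtain ⟨g, hg⟩ := htrans 1
    obtain ⟨g', hg'⟩ := htrans 2
    obtain ⟨r, hr, hr1, hrc⟩ := perm_three_cases _ _ hg hg'
    obtain ⟨h, rfl⟩ : ∃ h, r = π h := by
      rcases hr with rfl | rfl | rfl
      · exact ⟨_, rfl⟩
      · exact ⟨_, rfl⟩
      · exact ⟨g⁻¹ * g', by rw [map_mul, map_inv]⟩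
    refine (hM.exists_noncommuting hψ hψp (h := h) (fun h1 ↦ hr1 (by rw [h1, map_one]))
      fun u ↦ ?_).1
    rcases hrc (π u) with h1 | h1
    · exact Or.inl (hπinj (by rw [map_mul, map_mul, map_inv, h1]))
    · exact Or.inr (hπinj (by rw [map_mul, map_mul, map_inv, h1, map_inv]))
  push Not at hA
  obtain ⟨a, haA, ha1⟩ := hA
  by_cases hcomm : ∀ a ∈ A, ∀ c ∈ A, M a * M c = M c * M a
  · obtain ⟨b', -, -, -, hb'⟩ := hM.exists_permutesLines hψp A hAconj hcomm
      ⟨a, haA, fun h ↦ ha1 (hψ (by rw [h, map_one]))⟩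
    exact hM.hasOrbitOfLengthThree hb'
  push Not at hcomm
  obtain ⟨h, hhA, t, htA, hne⟩ := hcomm
  have hht := hAcomm h hhA t htA
  have hh3 := hM.cube_eq_one hψ hht hne
  have ht3 := hM.cube_eq_one hψ hht.symm hne.symm
  have hnz : ∀ i, b i ≠ 0 := b.ne_zero
  have hcube : ∀ g, g ^ 3 = 1 → ∀ χ : Fin 3 → k, (∀ i, L g • b i = χ i • b i) →
      ∀ i j, χ i ^ 3 = χ j ^ 3 := by
    intro g hg χ hχ i j
    have h1 : ProjGenLinGroup.mk (L g ^ 3) = ProjGenLinGroup.mk 1 := by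
      rw [map_pow, hL, ← map_pow, hg, map_one, map_one]
    obtain ⟨c, -, hc⟩ := mk_eq_mk_iff_smul.1 h1
    have h2 : ∀ i, χ i ^ 3 = c := fun i ↦ by
      have h3 := hc (b i)
      rw [pow_smul_eigenvector (hχ i), one_smul] at h3
      exact smul_left_injective k (hnz i) h3
    rw [h2, h2]
  -- The expression `χ 1 * χ 2 / χ 0 ^ 2` ignores scalars and is a cube root of unity on elements of
  -- order 3, so it is trivial on `h` or on some `t * h⁻ʲ`. Together with the equality of the cubes
  -- it makes the eigenvalues proportional to 1, ω, ω².
  obtain ⟨z, χ, hz1, hz3, hχ, hz⟩ : ∃ (z : G) (χ : Fin 3 → k), z ≠ 1 ∧ z ^ 3 = 1 ∧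
      (∀ i, L z • b i = χ i • b i) ∧ χ 1 * χ 2 = χ 0 ^ 2 := by
    choose χ hχ using hhA
    choose θ hθ using htA
    have hχ0 : ∀ i, χ i ≠ 0 := fun i ↦ eigenvalue_ne_zero (hnz i) (hχ i)
    have hθ0 : ∀ i, θ i ≠ 0 := fun i ↦ eigenvalue_ne_zero (hnz i) (hθ i)
    have hr : ∀ ρ : Fin 3 → k, (∀ i, ρ i ≠ 0) → (∀ i j, ρ i ^ 3 = ρ j ^ 3) →
        (ρ 1 * ρ 2 / ρ 0 ^ 2) ^ 3 = 1 := by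
      intro ρ h0 hρ
      have := h0 0
      rw [div_pow, mul_pow, hρ 1 0, hρ 2 0, div_eq_one_iff_eq (by positivity)]
      ring
    by_cases hr1 : χ 1 * χ 2 / χ 0 ^ 2 = 1
    · refine ⟨h, χ, fun h1 ↦ hM.ne_pow hne.symm 0 (by rw [h1, pow_zero]), hh3, hχ, ?_⟩
      rwa [div_eq_one_iff_eq (pow_ne_zero 2 (hχ0 0))] at hr1
    obtain ⟨j, -, hj⟩ := exists_pow_eq_of_cube_eq_one (hr χ hχ0 (hcube h hh3 χ hχ))
      (hr θ hθ0 (hcube t ht3 θ hθ)) hr1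
    have hmk : ProjGenLinGroup.mk (L (t * h ^ (2 * j))) =
        ProjGenLinGroup.mk (L t * L h ^ (2 * j)) := by
      rw [hL, map_mul, map_mul, map_pow, map_pow, hL, hL]
    obtain ⟨c, hc, hc'⟩ := mk_eq_mk_iff_smul.1 hmk
    refine ⟨t * h ^ (2 * j), fun i ↦ c * (χ i ^ (2 * j) * θ i), fun h1 ↦ hM.ne_pow hne j ?_, ?_,
      fun i ↦ ?_, ?_⟩
    · rw [← mul_left_inj (h ^ (2 * j)), h1, ← pow_add, show j + 2 * j = 3 * j by ring, pow_mul, hh3,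
        one_pow]
    · rw [Commute.mul_pow (Commute.pow_right hht.symm _), ht3, ← pow_mul, mul_comm, pow_mul, hh3,
        one_pow, one_mul]
    · rw [hc', mul_smul, pow_smul_eigenvector (hχ i), smul_comm (L t), hθ, smul_smul, smul_smul,
        mul_assoc]
    · rw [div_pow, div_eq_div_iff (pow_ne_zero _ (hθ0 0)) (pow_ne_zero _ (pow_ne_zero _ (hχ0 0)))]
        at hj
      have h12 : (χ 1 * χ 2) ^ (3 * j) = χ 0 ^ (3 * j) * χ 0 ^ (3 * j) := by
        rw [mul_pow, pow_mul, pow_mul, pow_mul, hcube h hh3 χ hχ 1 0, hcube h hh3 χ hχ 2 0]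
      have q : (χ 0 ^ 2) ^ j ≠ 0 := pow_ne_zero _ (pow_ne_zero _ (hχ0 0))
      apply mul_right_cancel₀ q
      calc c * (χ 1 ^ (2 * j) * θ 1) * (c * (χ 2 ^ (2 * j) * θ 2)) * (χ 0 ^ 2) ^ j
          = c ^ 2 * (χ 1 * χ 2) ^ (2 * j) * (θ 1 * θ 2 * (χ 0 ^ 2) ^ j) := by ring
        _ = c ^ 2 * (χ 1 * χ 2) ^ (3 * j) * θ 0 ^ 2 := by rw [hj]; ring
        _ = (c * (χ 0 ^ (2 * j) * θ 0)) ^ 2 * (χ 0 ^ 2) ^ j := by rw [h12]; ring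
  have hχ0 : ∀ i, χ i ≠ 0 := fun i ↦ eigenvalue_ne_zero (hnz i) (hχ i)
  have hω : (χ 1 / χ 0) ^ 3 = 1 := by
    rw [div_pow, hcube z hz3 χ hχ 1 0, div_self (pow_ne_zero 3 (hχ0 0))]
  refine (hM.exists_noncommuting hψ hψp hz1 fun g ↦
    hL.conj_eq_or_eq_inv hφ hb (hχ0 0) hω (fun i ↦ ?_) g).1
  rw [hχ]
  congr 1
  have h00 := hχ0 0
  have h11 := hχ0 1
  have h3 := hcube z hz3 χ hχ 1 0
  fin_cases i
  · simp
  · simp only [Fin.mk_one, Fin.isValue, pow_one]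
    field_simp
  · simp only [Fin.reduceFinMk, Fin.isValue]
    field_simp
    apply mul_right_cancel₀ h11
    linear_combination χ 0 * hz - h3

end Types

/-! ### The two subgroups and their classification -/

section Subgroups

variable {k : Type*} [Field k]

theorem basisFun_smul_diag (a b c : kˣ) : ∃ D : GL (Fin 3) k, ProjGenLinGroup.mk D = diag a b c ∧
    ∀ i, D • Pi.basisFun k (Fin 3) i = ((![a, b, c] i : kˣ) : k) • Pi.basisFun k (Fin 3) i := by
  refine ⟨_, rfl, fun i ↦ ?_⟩
  rw [gl_smul_def]
  fin_cases i <;> ext j <;> fin_cases j <;> simp [mulVec_single]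

theorem basisFun_smul_cyclic (i : Fin 3) :
    cyclicGL k • Pi.basisFun k (Fin 3) i = Pi.basisFun k (Fin 3) (i + 1) := by
  rw [gl_smul_def, cyclicGL_mulVec]
  fin_cases i <;> ext j <;> fin_cases j <;> simp

theorem mk_eq_diag {A : GL (Fin 3) k} {a b c : kˣ} {x : k} (hx : x ≠ 0)
    (h : ∀ i, A • Pi.basisFun k (Fin 3) i =
      (x * (![a, b, c] i : kˣ)) • Pi.basisFun k (Fin 3) i) :
    ProjGenLinGroup.mk A = diag a b c := by
  obtain ⟨D, hD, hDb⟩ := basisFun_smul_diag a b c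
  rw [← hD]
  exact mk_eq_mk_of_basis _ hx fun i ↦ by rw [h, hDb, smul_smul]

theorem mk_eq_cyclic {A : GL (Fin 3) k} {x : k} (hx : x ≠ 0)
    (h : ∀ i, A • Pi.basisFun k (Fin 3) i = x • Pi.basisFun k (Fin 3) (i + 1)) :
    ProjGenLinGroup.mk A = cyclic k :=
  mk_eq_mk_of_basis _ hx fun i ↦ by rw [h, basisFun_smul_cyclic]

theorem diag_mul (a b c a' b' c' : kˣ) :
    diag a b c * diag a' b' c' = diag (a * a') (b * b') (c * c') := by
  obtain ⟨D, hD, hDb⟩ := basisFun_smul_diag a b c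
  obtain ⟨D', hD', hDb'⟩ := basisFun_smul_diag a' b' c'
  rw [← hD, ← hD', ← map_mul]
  refine mk_eq_diag one_ne_zero fun i ↦ ?_
  rw [mul_smul, hDb', smul_comm D, hDb, smul_smul]
  congr 1
  fin_cases i <;> simp [mul_comm]

theorem diag_one : diag (1 : kˣ) 1 1 = 1 := by
  rw [← map_one ProjGenLinGroup.mk]
  refine (mk_eq_diag one_ne_zero fun i ↦ ?_).symm
  fin_cases i <;> simp

theorem diag_pow (a b c : kˣ) (j : ℕ) : diag a b c ^ j = diag (a ^ j) (b ^ j) (c ^ j) := by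
  induction j with
  | zero => simp [diag_one]
  | succ j ih => rw [pow_succ, ih, diag_mul, pow_succ, pow_succ, pow_succ]

theorem diag_eq_diag_iff {a b c a' b' c' : kˣ} : diag a b c = diag a' b' c' ↔
    ∃ u : kˣ, a = u * a' ∧ b = u * b' ∧ c = u * c' := by
  obtain ⟨D, hD, hDb⟩ := basisFun_smul_diag a b c
  obtain ⟨D', hD', hDb'⟩ := basisFun_smul_diag a' b' c'
  rw [← hD, ← hD']
  constructor
  · intro h
    obtain ⟨x, hx, h⟩ := mk_eq_mk_iff_smul.1 h
    have key : ∀ i, ((![a, b, c] i : kˣ) : k) = x * ((![a', b', c'] i : kˣ) : k) := by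
      intro i
      have h1 := h (Pi.basisFun k (Fin 3) i)
      rw [hDb, hDb', smul_smul] at h1
      exact smul_left_injective k ((Pi.basisFun k (Fin 3)).ne_zero i) h1
    refine ⟨Units.mk0 x hx, Units.ext (key 0), Units.ext (key 1), Units.ext (key 2)⟩
  · rintro ⟨u, rfl, rfl, rfl⟩
    refine mk_eq_mk_of_basis (Pi.basisFun k (Fin 3)) u.ne_zero fun i ↦ ?_
    rw [hDb, hDb', smul_smul]
    congr 1
    fin_cases i <;> simp

theorem cyclic_ne_diag (a b c : kˣ) : cyclic k ≠ diag a b c := by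
  intro h
  obtain ⟨D, hD, hDb⟩ := basisFun_smul_diag a b c
  rw [← hD] at h
  obtain ⟨x, hx, h⟩ := mk_eq_mk_iff_smul.1 h
  have h1 := congrFun (h (Pi.basisFun k (Fin 3) 0)) 1
  rw [hDb, basisFun_smul_cyclic] at h1
  simp at h1

theorem cyclic_cube : cyclic k ^ 3 = 1 := by
  rw [cyclic, ← map_pow]
  refine mk_eq_one_of_basis (Pi.basisFun k (Fin 3)) one_ne_zero fun i ↦ ?_
  rw [pow_succ, pow_two, mul_smul, mul_smul, basisFun_smul_cyclic, basisFun_smul_cyclic,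
    basisFun_smul_cyclic, one_smul]
  congr 1
  fin_cases i <;> rfl

variable {ζ : kˣ}

/-- Shifting the coordinates multiplies the diagonal entries by `ζ`, since `ζ ^ 3 = 1` closes the
cycle. On a common eigenvector this relation would force `ζ = 1`, which excludes a fixed point. -/
theorem diag_comm_cyclic_lift (hζ : ζ ^ 3 = 1) {D : GL (Fin 3) k}
    (hD : ∀ i, D • Pi.basisFun k (Fin 3) i =
      ((![1, ζ, ζ ^ 2] i : kˣ) : k) • Pi.basisFun k (Fin 3) i) (v : Fin 3 → k) :
    D • cyclicGL k • v = (ζ : k) • cyclicGL k • D • v := by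
  have h : D * cyclicGL k = (cyclicGL k * D) * GeneralLinearGroup.scalar (Fin 3) ζ := by
    refine gl_ext_basis (Pi.basisFun k (Fin 3)) fun i ↦ ?_
    rw [mul_smul, mul_smul, mul_smul, scalar_smul, smul_comm D (ζ : k), hD,
      smul_comm (cyclicGL k) (ζ : k), smul_comm (cyclicGL k) ((![1, ζ, ζ ^ 2] i : kˣ) : k),
      basisFun_smul_cyclic, hD, smul_smul]
    congr 1
    rw [← Units.val_mul]
    congr 1
    fin_cases i
    · simp
    · simp [pow_two]
    · simp [← pow_succ', hζ]
  rw [← mul_smul, h, mul_smul, scalar_smul, smul_comm, mul_smul]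

theorem diag_comm_cyclic (hζ : ζ ^ 3 = 1) :
    diag 1 ζ (ζ ^ 2) * cyclic k = cyclic k * diag 1 ζ (ζ ^ 2) := by
  obtain ⟨D, hD, hDb⟩ := basisFun_smul_diag 1 ζ (ζ ^ 2)
  rw [← hD, cyclic, ← map_mul, ← map_mul]
  refine mk_eq_mk_of_basis (Pi.basisFun k (Fin 3)) ζ.ne_zero fun i ↦ ?_
  rw [mul_smul, mul_smul, diag_comm_cyclic_lift hζ hDb]

theorem diagonalSubgroup_equiv (hζ : IsPrimitiveRoot ζ 3) :
    Nonempty (diagonalSubgroup ζ ≃* C3Squared) := by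
  have h3 := hζ.pow_eq_one
  have h1 : ζ ≠ 1 := hζ.ne_one (by norm_num)
  refine closure_pair_equiv ?_ ?_ ?_ ?_ fun j h ↦ ?_
  · rw [diag_mul, diag_mul, mul_comm 1 ζ]
  · rw [diag_pow, h3, one_pow, diag_one]
  · rw [diag_pow, h3, one_pow, diag_one]
  · rw [← diag_one, ne_eq, diag_eq_diag_iff]
    rintro ⟨u, hu, hu', -⟩
    rw [mul_one] at hu hu'
    exact h1 (hu'.trans hu.symm)
  · rw [diag_pow, diag_eq_diag_iff] at h
    obtain ⟨u, hu, -, hu'⟩ := h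
    rw [one_pow, mul_one] at hu hu'
    exact h1 (hu'.trans hu.symm)

theorem heisenbergSubgroup_equiv (hζ : IsPrimitiveRoot ζ 3) :
    Nonempty (heisenbergSubgroup ζ ≃* C3Squared) := by
  have h3 := hζ.pow_eq_one
  have h1 : ζ ≠ 1 := hζ.ne_one (by norm_num)
  refine closure_pair_equiv (diag_comm_cyclic h3) ?_ cyclic_cube ?_ fun j ↦ ?_
  · rw [diag_pow, h3, one_pow, ← pow_mul, mul_comm, pow_mul, h3, one_pow, diag_one]
  · rw [← diag_one, ne_eq, diag_eq_diag_iff]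
    rintro ⟨u, hu, hu', -⟩
    rw [mul_one] at hu hu'
    exact h1 (hu'.trans hu.symm)
  · rw [diag_pow]
    exact cyclic_ne_diag _ _ _

theorem diagonalSubgroup_fixesPoint (ζ : kˣ) : FixesPoint (diagonalSubgroup ζ).subtype := by
  refine ⟨Projectivization.mk k (Pi.basisFun k (Fin 3) 0) ((Pi.basisFun k _).ne_zero 0), ?_⟩
  rintro ⟨g, hg⟩
  have hle : diagonalSubgroup ζ ≤ MulAction.stabilizer PGL(3, k)
      (Projectivization.mk k (Pi.basisFun k (Fin 3) 0) ((Pi.basisFun k _).ne_zero 0)) := by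
    have hd : ∀ b c : kˣ, diag 1 b c ∈ MulAction.stabilizer PGL(3, k)
        (Projectivization.mk k (Pi.basisFun k (Fin 3) 0) ((Pi.basisFun k _).ne_zero 0)) := by
      intro b c
      obtain ⟨D, hD, hDb⟩ := basisFun_smul_diag 1 b c
      rw [MulAction.mem_stabilizer_iff, ← hD, Projectivization.PGL.mk_smul_mk,
        Projectivization.mk_eq_mk_iff']
      exact ⟨_, (hDb 0).symm⟩
    rw [diagonalSubgroup, Subgroup.closure_le]
    rintro _ (rfl | rfl)
    · exact hd _ _
    · exact hd _ _
  exact hle hg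

theorem finite_of_equiv {Γ : Type*} [Group Γ] (h : Nonempty (Γ ≃* C3Squared)) : Finite Γ := by
  obtain ⟨e⟩ := h
  have : Finite C3Squared := inferInstanceAs (Finite (ZMod 3 × ZMod 3))
  exact Finite.of_equiv _ e.symm.toEquiv

theorem comm_of_equiv {Γ : Type*} [Group Γ] (h : Nonempty (Γ ≃* C3Squared)) (x y : Γ) :
    x * y = y * x := by
  obtain ⟨e⟩ := h
  apply e.injective
  rw [map_mul, map_mul, mul_comm]

theorem cube_of_equiv {Γ : Type*} [Group Γ] (h : Nonempty (Γ ≃* C3Squared)) (x : Γ) :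
    x ^ 3 = 1 := by
  obtain ⟨e⟩ := h
  apply e.injective
  rw [map_pow, map_one]
  generalize e x = y
  revert y
  decide

theorem heisenbergSubgroup_hasType [IsAlgClosed k] [CharZero k] (hζ : IsPrimitiveRoot ζ 3) :
    HasType (heisenbergSubgroup ζ).subtype .imprimitive := by
  have heq := heisenbergSubgroup_equiv hζ
  have := finite_of_equiv heq
  have h1 : ζ ≠ 1 := hζ.ne_one (by norm_num)
  obtain ⟨M, hM⟩ := exists_isLift (heisenbergSubgroup ζ).subtype
  obtain ⟨D, hD, hDb⟩ := basisFun_smul_diag 1 ζ (ζ ^ 2)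
  let x : heisenbergSubgroup ζ := ⟨diag 1 ζ (ζ ^ 2), Subgroup.subset_closure (by simp)⟩
  let y : heisenbergSubgroup ζ := ⟨cyclic k, Subgroup.subset_closure (by simp)⟩
  have hfix : ¬ FixesPoint (heisenbergSubgroup ζ).subtype := by
    rw [hM.fixesPoint_iff]
    rintro ⟨v, hv, h⟩
    obtain ⟨a, ha⟩ := h x
    obtain ⟨b, hb⟩ := h y
    obtain ⟨c, hc, hcx⟩ := mk_eq_mk_iff_smul.1 (hD.trans (hM x).symm)
    obtain ⟨d, hd, hdy⟩ := mk_eq_mk_iff_smul.1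
      (show ProjGenLinGroup.mk (cyclicGL k) = _ from (hM y).symm)
    have hx : D • v = (c * a) • v := by rw [hcx, ha, smul_smul]
    have hy : cyclicGL k • v = (d * b) • v := by rw [hdy, hb, smul_smul]
    have h2 := diag_comm_cyclic_lift hζ.pow_eq_one hDb v
    rw [hy, smul_comm D, hx, smul_comm (cyclicGL k), hy, smul_comm (d * b)] at h2
    have h0 : (c * a) • (d * b) • v ≠ 0 :=
      smul_ne_zero (eigenvalue_ne_zero hv hx) (smul_ne_zero (eigenvalue_ne_zero hv hy) hv)
    exact h1 (Units.ext (smul_left_injective k h0 ((one_smul _ _).trans h2)).symm)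
  refine ⟨hfix, (hM.exists_noncommuting Subtype.val_injective hfix (h := x) (fun hx ↦ ?_)
    fun g ↦ Or.inl ?_).1⟩
  · have h2 : diag 1 ζ (ζ ^ 2) = diag 1 1 1 := (congrArg Subtype.val hx).trans diag_one.symm
    obtain ⟨u, hu, hu', -⟩ := diag_eq_diag_iff.1 h2
    rw [mul_one] at hu hu'
    exact h1 (hu'.trans hu.symm)
  · rw [comm_of_equiv heq g x, mul_inv_cancel_right]

theorem AreConjugate.fixesPoint {H K : Subgroup PGL(3, k)} (h : AreConjugate H K)
    (hH : FixesPoint H.subtype) : FixesPoint K.subtype := by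
  obtain ⟨g, rfl⟩ := h
  obtain ⟨p, hp⟩ := hH
  refine ⟨g • p, ?_⟩
  rintro ⟨_, a, ha, rfl⟩
  have := hp ⟨a, ha⟩
  change a • p = p at this
  change (g * a * g⁻¹) • g • p = g • p
  rw [mul_smul, mul_smul, inv_smul_smul, this]

theorem exists_smul_basis_eq (b : Basis (Fin 3) k (Fin 3 → k)) :
    ∃ P : GL (Fin 3) k, ∀ i, P⁻¹ • Pi.basisFun k (Fin 3) i = b i := by
  let P : GL (Fin 3) k := GeneralLinearGroup.toLin.symm
    (LinearMap.GeneralLinearGroup.ofLinearEquiv b.equivFun)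
  refine ⟨P, fun i ↦ ?_⟩
  rw [inv_smul_eq_iff]
  have h : P • b i = b.equivFun (b i) := by
    change Matrix.toLin' (P : Matrix (Fin 3) (Fin 3) k) (b i) = _
    have h2 : GeneralLinearGroup.toLin P =
      LinearMap.GeneralLinearGroup.ofLinearEquiv b.equivFun := MulEquiv.apply_symm_apply _ _
    exact congrArg (fun f : LinearMap.GeneralLinearGroup k (Fin 3 → k) ↦ f.val (b i)) h2
  rw [h]
  ext j
  simp [Pi.single_apply, eq_comm]

/-- Up to conjugation there are only two subgroups of `PGL₃` that are isomorphic to `C₃²`. -/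
theorem areConjugate_of_equiv [IsAlgClosed k] [CharZero k] (hζ : IsPrimitiveRoot ζ 3)
    (H : Subgroup PGL(3, k)) (hH : Nonempty (H ≃* C3Squared)) :
    AreConjugate H (diagonalSubgroup ζ) ∨ AreConjugate H (heisenbergSubgroup ζ) := by
  have := finite_of_equiv hH
  have hcard : ∀ (P : PGL(3, k)) (K : Subgroup PGL(3, k)), Nonempty (K ≃* C3Squared) →
      Nat.card (H.map (MulAut.conj P).toMonoidHom) = Nat.card K := by
    rintro P K ⟨e'⟩
    obtain ⟨e⟩ := hH
    rw [← Nat.card_congr (H.equivMapOfInjective (MulAut.conj P).toMonoidHom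
      (MulAut.conj P).injective).toEquiv]
    exact Nat.card_congr (e.trans e'.symm).toEquiv
  have hfin : ∀ P : PGL(3, k), Finite (H.map (MulAut.conj P).toMonoidHom) := fun P ↦
    Finite.of_equiv _ (H.equivMapOfInjective (MulAut.conj P).toMonoidHom
      (MulAut.conj P).injective).toEquiv
  obtain ⟨M, hM⟩ := exists_isLift H.subtype
  by_cases hcomm : ∀ a c, M a * M c = M c * M a
  · left
    obtain ⟨b, χ, hχ⟩ := exists_common_eigenbasis M hcomm hM.isOfFinOrder
    obtain ⟨P, hP⟩ := exists_smul_basis_eq b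
    have := finite_of_equiv (diagonalSubgroup_equiv hζ)
    -- The two groups have the same order, so one inclusion suffices.
    refine ⟨ProjGenLinGroup.mk P, Subgroup.eq_of_le_of_card_ge ?_
      (hcard _ _ (diagonalSubgroup_equiv hζ)).ge⟩
    rintro _ ⟨h, hh, rfl⟩
    have hχh := hχ ⟨h, hh⟩
    set a : Fin 3 → k := χ ⟨h, hh⟩ with ha
    have ha0 : ∀ i, a i ≠ 0 := fun i ↦ eigenvalue_ne_zero (b.ne_zero i) (hχh i)
    have h3 : ∀ i, (a i / a 0) ^ 3 = 1 := by
      have h4 : ProjGenLinGroup.mk (M ⟨h, hh⟩ ^ 3) = ProjGenLinGroup.mk 1 := by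
        rw [map_pow, hM, ← map_pow, cube_of_equiv hH, map_one, map_one]
      obtain ⟨c, hc, hc'⟩ := mk_eq_mk_iff_smul.1 h4
      have h5 : ∀ i, a i ^ 3 = c := fun i ↦ by
        have h6 := hc' (b i)
        rw [pow_smul_eigenvector (hχh i), one_smul] at h6
        exact smul_left_injective k (b.ne_zero i) h6
      intro i
      rw [div_pow, h5, h5, div_self hc]
    have hζ3 : (ζ : k) ^ 3 = 1 := by rw [← Units.val_pow_eq_pow_val, hζ.pow_eq_one, Units.val_one]
    have hζ1 : (ζ : k) ≠ 1 := fun h ↦ hζ.ne_one (by norm_num) (Units.ext h)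
    obtain ⟨i, -, hi⟩ := exists_pow_eq_of_cube_eq_one hζ3 (h3 1) hζ1
    obtain ⟨j, -, hj⟩ := exists_pow_eq_of_cube_eq_one hζ3 (h3 2) hζ1
    have hd : (MulAut.conj (ProjGenLinGroup.mk P)).toMonoidHom h = diag 1 (ζ ^ i) (ζ ^ j) := by
      have h7 : h = ProjGenLinGroup.mk (M ⟨h, hh⟩) := (hM ⟨h, hh⟩).symm
      have h8 : (MulAut.conj (ProjGenLinGroup.mk P)).toMonoidHom h =
          ProjGenLinGroup.mk (P * M ⟨h, hh⟩ * P⁻¹) := by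
        rw [map_mul, map_mul, map_inv, ← h7]
        rfl
      rw [h8]
      refine mk_eq_diag (ha0 0) fun m ↦ ?_
      rw [mul_smul, mul_smul, hP, hχh, smul_comm P, ← hP, smul_inv_smul]
      congr 1
      have h00 := ha0 0
      fin_cases m
      · simp
      · simp [← hi]
        field_simp
      · simp [← hj]
        field_simp
    rw [hd]
    have h9 : diag 1 (ζ ^ i) (ζ ^ j) = diag 1 ζ 1 ^ i * diag 1 1 ζ ^ j := by
      rw [diag_pow, diag_pow, diag_mul]
      simp
    rw [h9]
    exact mul_mem (pow_mem (Subgroup.subset_closure (by simp)) i)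
      (pow_mem (Subgroup.subset_closure (by simp)) j)
  · right
    push Not at hcomm
    -- The commutator scalar is `ζ` or its inverse; exchanging the two elements turns one into the
    -- other.
    obtain ⟨a, c, hω⟩ : ∃ a c, ∀ v : Fin 3 → k, M a • M c • v = (ζ : k) • M c • M a • v := by
      obtain ⟨a, c, hne⟩ := hcomm
      obtain ⟨ω, -, h⟩ := hM.swap (comm_of_equiv hH a c)
      have hω1 := comm_ne_one hne h
      have hω3 := cube_eq_one_of_comm h
      have hζ3 : (ζ : k) ^ 3 = 1 := by rw [← Units.val_pow_eq_pow_val, hζ.pow_eq_one, Units.val_one]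
      obtain ⟨j, hj, hjω⟩ := exists_pow_eq_of_cube_eq_one hω3 hζ3 hω1
      interval_cases j
      · exact absurd (Units.ext (by simpa using hjω)) (hζ.ne_one (by norm_num))
      · exact ⟨a, c, by rw [hjω, pow_one]; exact h⟩
      · refine ⟨c, a, fun v ↦ ?_⟩
        rw [h, hjω, smul_smul (ω ^ 2) ω, ← pow_succ, hω3, one_smul]
    obtain ⟨b, β, γ, hβ, hγ, hB, hC⟩ := exists_heisenberg_basis
      (fun h ↦ hζ.ne_one (by norm_num) (Units.ext h)) hω
    obtain ⟨P, hP⟩ := exists_smul_basis_eq b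
    have := hfin (ProjGenLinGroup.mk P)
    refine ⟨ProjGenLinGroup.mk P, (Subgroup.eq_of_le_of_card_ge ?_
      (hcard _ _ (heisenbergSubgroup_equiv hζ)).le).symm⟩
    have hconj : ∀ x : H, ProjGenLinGroup.mk (P * M x * P⁻¹) ∈
        H.map (MulAut.conj (ProjGenLinGroup.mk P)).toMonoidHom := by
      intro x
      refine ⟨x, x.2, ?_⟩
      rw [map_mul, map_mul, map_inv, hM]
      rfl
    rw [heisenbergSubgroup, Subgroup.closure_le]
    rintro _ (rfl | rfl)
    · have h1 : ProjGenLinGroup.mk (P * M a * P⁻¹) = diag 1 ζ (ζ ^ 2) := by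
        refine mk_eq_diag hβ fun m ↦ ?_
        rw [mul_smul, mul_smul, hP, hB, smul_comm P, ← hP, smul_inv_smul]
        congr 1
        fin_cases m <;> simp
      rw [← h1]
      exact hconj a
    · have h1 : ProjGenLinGroup.mk (P * M c * P⁻¹) = cyclic k := by
        refine mk_eq_cyclic hγ fun m ↦ ?_
        rw [mul_smul, mul_smul, hP, hC, smul_comm P, ← hP, smul_inv_smul]
      rw [← h1]
      exact hconj c

end Subgroups

end PlaneAction

theorem mainTheorem6 {k : Type*} [Field k] [IsAlgClosed k] [CharZero k]
    (ζ : kˣ) (hζ : IsPrimitiveRoot ζ 3) :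
    (∀ {G : Type*} [Group G] [Finite G] (φ ψ : G →* PGL(3, k)),
      Function.Injective φ → Function.Injective ψ →
      ∀ s t : PlaneAction.ActionType,
        PlaneAction.HasType φ s → PlaneAction.HasType ψ t → s ≠ t →
        Nonempty (G ≃* PlaneAction.C3Squared) ∧
          ((s = .intransitive ∧ t = .imprimitive) ∨ (s = .imprimitive ∧ t = .intransitive))) ∧
    Nonempty (PlaneAction.diagonalSubgroup ζ ≃* PlaneAction.C3Squared) ∧
    PlaneAction.HasType (PlaneAction.diagonalSubgroup ζ).subtype .intransitive ∧
    Nonempty (PlaneAction.heisenbergSubgroup ζ ≃* PlaneAction.C3Squared) ∧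
    PlaneAction.HasType (PlaneAction.heisenbergSubgroup ζ).subtype .imprimitive ∧
    ¬ PlaneAction.AreConjugate (PlaneAction.diagonalSubgroup ζ)
        (PlaneAction.heisenbergSubgroup ζ) ∧
    (∀ H : Subgroup PGL(3, k), Nonempty (H ≃* PlaneAction.C3Squared) →
      PlaneAction.AreConjugate H (PlaneAction.diagonalSubgroup ζ) ∨
        PlaneAction.AreConjugate H (PlaneAction.heisenbergSubgroup ζ)) := by
  refine ⟨?_, PlaneAction.diagonalSubgroup_equiv hζ, PlaneAction.diagonalSubgroup_fixesPoint ζ,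
    PlaneAction.heisenbergSubgroup_equiv hζ, PlaneAction.heisenbergSubgroup_hasType hζ,
    fun h ↦ (PlaneAction.heisenbergSubgroup_hasType hζ).1
      (h.fixesPoint (PlaneAction.diagonalSubgroup_fixesPoint ζ)),
    PlaneAction.areConjugate_of_equiv hζ⟩
  intro G _ _ φ ψ hφ hψ s t hs ht hst
  cases s <;> cases t
  · exact absurd rfl hst
  · exact ⟨(PlaneAction.fixesPoint_and_not_fixesPoint hφ hψ hs ht.1).2, Or.inl ⟨rfl, rfl⟩⟩
  · exact absurd (PlaneAction.fixesPoint_and_not_fixesPoint hφ hψ hs ht.1).1 ht.2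
  · exact ⟨(PlaneAction.fixesPoint_and_not_fixesPoint hψ hφ ht hs.1).2, Or.inr ⟨rfl, rfl⟩⟩
  · exact absurd rfl hst
  · exact absurd (PlaneAction.hasOrbitOfLengthThree_of_hasOrbitOfLengthThree hφ hψ hs.1 ht.1 hs.2)
      ht.2
  · exact absurd (PlaneAction.fixesPoint_and_not_fixesPoint hψ hφ ht hs.1).1 hs.2
  · exact absurd (PlaneAction.hasOrbitOfLengthThree_of_hasOrbitOfLengthThree hψ hφ ht.1 hs.1 ht.2)
      hs.2
  · exact absurd rfl hst
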